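/- Setting. For an index $n$ (the limit is along any sequence, or more generally any filter, of indices) let $p=p_n$, $T=T_n$ be dimensions and let $r$ be fixed. The data are $X=FB^\top+E\in\mathbb R^{T\times p}$, with random factor scores $F=(f_{tk})\in\mathbb R^{T\times r}$, deterministic loadings $B=(b_{jk})\in\mathbb R^{p\times r}$, errors $E$, and common components $C=FB^\top$, all random objects living on one probability space. A network on the $p$ variables is given by a symmetric adjacency matrix $A\in\{0,1\}^{p\times p}$; its normalized Laplacian is $\mathcal L_n=\bar d^{-1}(\mathrm{diag}(d_1,\dots,d_p)-A)$ with $d_i=\sum_jA_{ij}$ and $\bar d=p^{-1}\sum_id_i$ (and $\mathcal L_n=0$ if there are no edges). For a deterministic tuning parameter $\alpha=\alpha_n\ge0$, either $D=I_p+\alpha\mathcal L_n$ for all $n$ (Laplacian penalty), or $D=I_p+\alpha U_1U_1^\top$ for all $n$ (Projection penalty), where, for a deterministic $0\le m=m_n\le p$, the columns of $U_1$ are the leading $p-m$ orthonormal eigenvectors of $\mathcal L_n$ (eigenvalues in decreasing order). Assumptions (constants do not depend on $n$; conditions on the objects with index $n$ are required for all sufficiently large $n$). (A) $p,T\to\infty$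 and $T\le Cp$ for a constant $C>0$. (B) For some $M>0$: $\mathbb E f_{tk}=0$, $\mathbb E f_{tk}^2=1$, $\mathbb E f_{tk}^4\le M$ for all $t,k$; $F^\top F/T=I_r$ almost surely; $\mathbb E\|v^\top F\|^2\le M$ for every $v\in\mathbb R^T$ with $\|v\|=1$. (C) $|b_{jk}|\le M$ for some $M>0$ and all $j,k$, and $p^{-1}B^\top B\to\Sigma_B$ with $c_1\ge\lambda_1(\Sigma_B)>\dots>\lambda_r(\Sigma_B)\ge c_2$ for some $c_1,c_2>0$. (D) $E=P_1\mathcal EP_2$ with deterministic square matrices $P_1,P_2$ and $\mathcal E=(\epsilon_{tj})_{T\times p}$ having independent entries with $\mathbb E\epsilon_{tj}=0$, $\mathbb E\epsilon_{tj}^2=1$, $\mathbb E\epsilon_{tj}^4\le M$; all eigenvalues of $P_1^\top P_1$ and of $P_2^\top P_2$ lie in $[c_2,c_1]$ for some $c_1,c_2>0$; and $\mathcal E$ is independent of $F$. (E) For some $c>0$, the matrix $S=p^{-1}B^\top D^{-1}B$ satisfies $\lambda_1(S)>\dots>\lambda_r(S)\ge c$. Estimators. $\hat F$ is $\sqrt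 T$ times a (measurable) choice of leading $r$ orthonormal eigenvectors of $(pT)^{-1}XD^{-1}X^\top$, $\hat B=T^{-1}D^{-1}X^\top\hat F$, and $\hat C=\hat F\hat B^\top$. Theorem. Under (A)–(E) there exist invertible random $r\times r$ matrices $H=H_n$ (depending on $p,T$ and the tuning parameters) such that $H^\top H\to I_r$ in probability and $$\frac1T\|\hat F-FH\|_F^2=O_p\Big(\frac1p+\frac{\mathrm{tr}(D^{-2})}{pT^2}\Big),$$ $$\frac1p\|\hat B-BH\|_F^2=O_p\Big(\frac1p\|(D^{-1}-I_p)B\|_F^2+\frac{\mathrm{tr}(D^{-2})}{pT}\Big),$$ $$\frac1{pT}\|\hat C-C\|_F^2=O_p\Big(\frac1p\|(D^{-1}-I_p)B\|_F^2+\frac{\mathrm{tr}(D^{-2})}{pT}+\frac1p\Big).$$ -/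

import Mathlib

open MeasureTheory ProbabilityTheory Filter Topology Matrix

namespace NFM

/-! ### Matrices -/

/-- The squared Frobenius norm `‖A‖_F²`. -/
def frobSq {a b : ℕ} (A : Matrix (Fin a) (Fin b) ℝ) : ℝ :=
  ∑ i, ∑ j, A i j ^ 2

/-- `G = W diag(lam) Wᵀ` with `W` orthogonal and the eigenvalues `lam` listed in decreasing order
(with multiplicity): the columns of `W` are the eigenvectors of `G`. -/
structure IsSpectralDecomposition {N : ℕ} (G W : Matrix (Fin N) (Fin N) ℝ)
    (lam : Fin N → ℝ) : Prop where
  orthogonal : Wᵀ * W = 1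
  antitone : Antitone lam
  eq_mul : G = W * Matrix.diagonal lam * Wᵀ

/-- The columns of `V` are the leading `k` eigenvectors of `G`: the first `k` columns in some
spectral decomposition of `G`, eigenvalues in decreasing order. -/
def IsLeadingEigenvectors {N k : ℕ} (G : Matrix (Fin N) (Fin N) ℝ)
    (V : Matrix (Fin N) (Fin k) ℝ) : Prop :=
  ∃ (hk : k ≤ N) (W : Matrix (Fin N) (Fin N) ℝ) (lam : Fin N → ℝ),
    IsSpectralDecomposition G W lam ∧ V = W.submatrix id (Fin.castLE hk)

/-! ### The network and the two penalties -/

/-- Adjacency matrix of an undirected network on `p` variables. -/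
structure IsAdjacency {p : ℕ} (A : Matrix (Fin p) (Fin p) ℝ) : Prop where
  symm : A.IsSymm
  zero_or_one : ∀ i j, A i j = 0 ∨ A i j = 1

/-- The degree of a variable. -/
def degree {p : ℕ} (A : Matrix (Fin p) (Fin p) ℝ) (i : Fin p) : ℝ :=
  ∑ j, A i j

/-- The Laplacian `𝓛 = diag(degrees) - A`. -/
def laplacian {p : ℕ} (A : Matrix (Fin p) (Fin p) ℝ) : Matrix (Fin p) (Fin p) ℝ :=
  Matrix.diagonal (degree A) - A

/-- The average degree. -/
noncomputable def avgDegree {p : ℕ} (A : Matrix (Fin p) (Fin p) ℝ) : ℝ :=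
  (p : ℝ)⁻¹ * ∑ i, degree A i

/-- The normalized Laplacian: the Laplacian divided by the average degree.
For the network without edges it is the zero matrix. -/
noncomputable def normLaplacian {p : ℕ} (A : Matrix (Fin p) (Fin p) ℝ) :
    Matrix (Fin p) (Fin p) ℝ :=
  (avgDegree A)⁻¹ • laplacian A

/-- Laplacian penalty: `D = I_p + α 𝓛_n`. -/
def IsLaplacianPenalty {p : ℕ} (A : Matrix (Fin p) (Fin p) ℝ) (α : ℝ)
    (D : Matrix (Fin p) (Fin p) ℝ) : Prop :=
  D = 1 + α • normLaplacian A

/-- Projection penalty: `D = I_p + α U₁ U₁ᵀ`, where the columns of `U₁` are the leading `p - m`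
eigenvectors of `𝓛_n`. -/
def IsProjectionPenalty {p : ℕ} (A : Matrix (Fin p) (Fin p) ℝ) (α : ℝ) (m : ℕ)
    (D : Matrix (Fin p) (Fin p) ℝ) : Prop :=
  m ≤ p ∧ ∃ U₁ : Matrix (Fin p) (Fin (p - m)) ℝ,
    IsLeadingEigenvectors (normLaplacian A) U₁ ∧ D = 1 + α • (U₁ * U₁ᵀ)

/-! ### The model and the estimators -/

/-- Common components `C = F Bᵀ`. -/
def common {T p r : ℕ} (F : Matrix (Fin T) (Fin r) ℝ) (B : Matrix (Fin p) (Fin r) ℝ) :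
    Matrix (Fin T) (Fin p) ℝ :=
  F * Bᵀ

/-- The observed data `X = F Bᵀ + E`. -/
def data {T p r : ℕ} (F : Matrix (Fin T) (Fin r) ℝ) (B : Matrix (Fin p) (Fin r) ℝ)
    (E : Matrix (Fin T) (Fin p) ℝ) : Matrix (Fin T) (Fin p) ℝ :=
  common F B + E

/-- `Fhat` is `√T` times the leading `r` eigenvectors of `(pT)⁻¹ X D⁻¹ Xᵀ`. -/
def IsScoreEstimator {T p r : ℕ} (X : Matrix (Fin T) (Fin p) ℝ)
    (D : Matrix (Fin p) (Fin p) ℝ) (Fhat : Matrix (Fin T) (Fin r) ℝ) : Prop :=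
  ∃ V : Matrix (Fin T) (Fin r) ℝ,
    IsLeadingEigenvectors (((p : ℝ) * T)⁻¹ • (X * D⁻¹ * Xᵀ)) V ∧ Fhat = √(T : ℝ) • V

/-- The estimated loadings `T⁻¹ D⁻¹ Xᵀ Fhat`. -/
noncomputable def loadingEstimator {T p r : ℕ} (X : Matrix (Fin T) (Fin p) ℝ)
    (D : Matrix (Fin p) (Fin p) ℝ) (Fhat : Matrix (Fin T) (Fin r) ℝ) :
    Matrix (Fin p) (Fin r) ℝ :=
  (T : ℝ)⁻¹ • (D⁻¹ * Xᵀ * Fhat)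

/-! ### Assumptions

The asymptotics are along a filter `l` on an index type `ι`, with dimensions `p n` and `T n`:
`ι = ℕ` and `l = atTop` is a sequence of dimensions, and `ι = ℕ × ℕ` gives joint limits in `(p, T)`.
The loadings, the network and the tuning parameters may all depend on the index. -/

/-- `p, T → ∞` with `T ≤ C p`. -/
def AssumptionA {ι : Type*} (l : Filter ι) (p T : ι → ℕ) : Prop :=
  Tendsto p l atTop ∧ Tendsto T l atTop ∧ ∃ C : ℝ, 0 < C ∧ ∀ᶠ n in l, (T n : ℝ) ≤ C * p n

/-- The conditions on the `T × r` factor matrix `F`, with moment bound `M`. -/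
structure FactorCondition {Ω : Type*} [MeasurableSpace Ω] (μ : Measure Ω) {T r : ℕ}
    (F : Ω → Matrix (Fin T) (Fin r) ℝ) (M : ℝ) : Prop where
  measurable : ∀ t k, Measurable fun ω => F ω t k
  memLp : ∀ t k, MemLp (fun ω => F ω t k) 4 μ
  mean : ∀ t k, ∫ ω, F ω t k ∂μ = 0
  second : ∀ t k, ∫ ω, F ω t k ^ 2 ∂μ = 1
  fourth : ∀ t k, ∫ ω, F ω t k ^ 4 ∂μ ≤ M
  normalized : ∀ᵐ ω ∂μ, (T : ℝ)⁻¹ • ((F ω)ᵀ * F ω) = 1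
  weak_dependence : ∀ v : Fin T → ℝ, ∑ t, v t ^ 2 = 1 →
    ∫ ω, ∑ k, (∑ t, v t * F ω t k) ^ 2 ∂μ ≤ M

/-- Factor scores. -/
def AssumptionB {Ω : Type*} [MeasurableSpace Ω] (μ : Measure Ω) {ι : Type*} (l : Filter ι)
    {r : ℕ} {T : ι → ℕ} (F : ∀ n, Ω → Matrix (Fin (T n)) (Fin r) ℝ) : Prop :=
  ∃ M : ℝ, 0 < M ∧ ∀ᶠ n in l, FactorCondition μ (F n) M

/-- Factor loadings. -/
def AssumptionC {ι : Type*} (l : Filter ι) {r : ℕ} {p : ι → ℕ}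
    (B : ∀ n, Matrix (Fin (p n)) (Fin r) ℝ) : Prop :=
  (∃ M : ℝ, 0 < M ∧ ∀ᶠ n in l, ∀ j k, |B n j k| ≤ M) ∧
  ∃ (SigmaB W : Matrix (Fin r) (Fin r) ℝ) (lam : Fin r → ℝ) (c₁ c₂ : ℝ),
    Tendsto (fun n => (p n : ℝ)⁻¹ • ((B n)ᵀ * B n)) l (𝓝 SigmaB) ∧
    IsSpectralDecomposition SigmaB W lam ∧ StrictAnti lam ∧
    0 < c₁ ∧ 0 < c₂ ∧ ∀ k, c₂ ≤ lam k ∧ lam k ≤ c₁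

/-- The conditions on the `T × p` error matrix `E = P₁ ε P₂`, where `ε` is independent of `F`. -/
structure ErrorCondition {Ω : Type*} [MeasurableSpace Ω] (μ : Measure Ω) {T p r : ℕ}
    (F : Ω → Matrix (Fin T) (Fin r) ℝ) (E ε : Ω → Matrix (Fin T) (Fin p) ℝ)
    (P₁ : Matrix (Fin T) (Fin T) ℝ) (P₂ : Matrix (Fin p) (Fin p) ℝ) (M c₁ c₂ : ℝ) : Prop where
  eq_mul : ∀ ω, E ω = P₁ * ε ω * P₂
  measurable : ∀ t j, Measurable fun ω => ε ω t j
  indep : iIndepFun (fun (q : Fin T × Fin p) ω => ε ω q.1 q.2) μ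
  memLp : ∀ t j, MemLp (fun ω => ε ω t j) 4 μ
  mean : ∀ t j, ∫ ω, ε ω t j ∂μ = 0
  second : ∀ t j, ∫ ω, ε ω t j ^ 2 ∂μ = 1
  fourth : ∀ t j, ∫ ω, ε ω t j ^ 4 ∂μ ≤ M
  spectrum_left : spectrum ℝ (P₁ᵀ * P₁) ⊆ Set.Icc c₂ c₁
  spectrum_right : spectrum ℝ (P₂ᵀ * P₂) ⊆ Set.Icc c₂ c₁
  indep_factor : IndepFun (fun ω (q : Fin T × Fin p) => ε ω q.1 q.2)
    (fun ω (q : Fin T × Fin r) => F ω q.1 q.2) μ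

/-- Idiosyncratic errors. -/
def AssumptionD {Ω : Type*} [MeasurableSpace Ω] (μ : Measure Ω) {ι : Type*} (l : Filter ι)
    {r : ℕ} {p T : ι → ℕ} (F : ∀ n, Ω → Matrix (Fin (T n)) (Fin r) ℝ)
    (E : ∀ n, Ω → Matrix (Fin (T n)) (Fin (p n)) ℝ) : Prop :=
  ∃ M c₁ c₂ : ℝ, 0 < M ∧ 0 < c₁ ∧ 0 < c₂ ∧ ∀ᶠ n in l,
    ∃ (ε : Ω → Matrix (Fin (T n)) (Fin (p n)) ℝ) (P₁ : Matrix (Fin (T n)) (Fin (T n)) ℝ)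
      (P₂ : Matrix (Fin (p n)) (Fin (p n)) ℝ), ErrorCondition μ (F n) (E n) ε P₁ P₂ M c₁ c₂

/-- Factors stay informative after shrinkage: the eigenvalues of `S = p⁻¹ Bᵀ D⁻¹ B` are distinct
and bounded away from zero. -/
def AssumptionE {ι : Type*} (l : Filter ι) {r : ℕ} {p : ι → ℕ}
    (B : ∀ n, Matrix (Fin (p n)) (Fin r) ℝ) (D : ∀ n, Matrix (Fin (p n)) (Fin (p n)) ℝ) : Prop :=
  ∃ c : ℝ, 0 < c ∧ ∀ᶠ n in l, ∃ (W : Matrix (Fin r) (Fin r) ℝ) (lam : Fin r → ℝ),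
    IsSpectralDecomposition ((p n : ℝ)⁻¹ • ((B n)ᵀ * (D n)⁻¹ * B n)) W lam ∧
    StrictAnti lam ∧ ∀ k, c ≤ lam k

/-! ### Stochastic order -/

/-- `Y n = O_p(a n)` along `l`: for every `δ > 0` there is a constant `K` such that, eventually,
`|Y n| > K |a n|` has probability at most `δ`. -/
def IsBigOp {Ω : Type*} [MeasurableSpace Ω] (μ : Measure Ω) {ι : Type*} (l : Filter ι)
    (Y : ι → Ω → ℝ) (a : ι → ℝ) : Prop :=
  ∀ δ : ℝ, 0 < δ → ∃ K : ℝ, 0 < K ∧ ∀ᶠ n in l, μ {ω | K * |a n| < |Y n ω|} ≤ ENNReal.ofReal δ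

end NFM

/-! Write `K = D⁻¹`. Both penalties are the identity plus a positive semidefinite matrix, so `K` is
a symmetric positive semidefinite contraction, and `tr(K²) = ‖K‖_F² ≤ p`. The matrix `H` is the
least squares coefficient `T⁻¹ Fᵀ Fhat`, with residual `R = Fhat - F H` orthogonal to the columns of
`F`. Hence `R` is minimal among all `Fhat - F H'`, and since `Fhatᵀ Fhat = Fᵀ F = T I`, one has
exactly `Hᵀ H - I = -T⁻¹ Rᵀ R`. The near-orthogonality of `H` thus follows from the score rate.

Scores: the eigenvector equation gives `Fhat = G Fhat Λ⁻¹` with `G = (pT)⁻¹ X K Xᵀ`. The terms of `X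
K Xᵀ` that begin with `F` are absorbed into `F H'`; what remains is `E K B Fᵀ + E K Eᵀ`. On the
column space of `F` the signal dominates the cross terms, so the leading eigenvalues in `Λ` are at
least `c / 2` (`le_eigenvalue`, `le_quadratic`). The noise form `E K Eᵀ` is a multiple of `P₁ P₁ᵀ`
of size `tr(P₂ K P₂ᵀ)`, whose square is of order `p tr(K²)`, plus a fluctuation of squared Frobenius
norm of order `T² tr(K²)`. After scaling these give `tr(K²) / (p T²)` and `tr(K²) / p² ≤ 1 / p`.

Loadings: the error splits into the shrinkage bias, noise against the true factors and noise against
`R` (`loading_error_eq`). Common components: a telescoping identity combines the two rates.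

Probability enters only through four second-moment bounds and Markov's inequality
(`measure_not_isRegularSample_le`). On the resulting event all estimates are deterministic, and
`IsBigOp.of_regular` turns them into `O_p` statements. -/

namespace NFM

/-! ### Frobenius norm -/

section Frobenius

variable {a b c : ℕ}

theorem frobSq_nonneg (A : Matrix (Fin a) (Fin b) ℝ) : 0 ≤ frobSq A :=
  Finset.sum_nonneg fun _ _ => Finset.sum_nonneg fun _ _ => sq_nonneg _

theorem frobSq_eq_trace (A : Matrix (Fin a) (Fin b) ℝ) : frobSq A = (Aᵀ * A).trace := by
  simp only [frobSq, Matrix.trace, Matrix.diag, Matrix.mul_apply, Matrix.transpose_apply]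
  rw [Finset.sum_comm]
  simp only [sq]

theorem frobSq_transpose (A : Matrix (Fin a) (Fin b) ℝ) : frobSq Aᵀ = frobSq A := by
  simp only [frobSq, Matrix.transpose_apply]
  rw [Finset.sum_comm]

theorem frobSq_smul (x : ℝ) (A : Matrix (Fin a) (Fin b) ℝ) :
    frobSq (x • A) = x ^ 2 * frobSq A := by
  simp only [frobSq, Matrix.smul_apply, smul_eq_mul, mul_pow, Finset.mul_sum]

theorem frobSq_add_le (A B : Matrix (Fin a) (Fin b) ℝ) :
    frobSq (A + B) ≤ 2 * (frobSq A + frobSq B) := by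
  simp only [frobSq, Matrix.add_apply, ← Finset.sum_add_distrib, Finset.mul_sum]
  gcongr with i _ j _
  nlinarith [sq_nonneg (A i j - B i j)]

theorem frobSq_add_add_le (A B C : Matrix (Fin a) (Fin b) ℝ) :
    frobSq (A + B + C) ≤ 3 * (frobSq A + frobSq B + frobSq C) := by
  simp only [frobSq, Matrix.add_apply, ← Finset.sum_add_distrib, Finset.mul_sum]
  gcongr with i _ j _
  nlinarith [sq_nonneg (A i j - B i j), sq_nonneg (A i j - C i j), sq_nonneg (B i j - C i j)]

theorem frobSq_mul_le (A : Matrix (Fin a) (Fin b) ℝ) (B : Matrix (Fin b) (Fin c) ℝ) :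
    frobSq (A * B) ≤ frobSq A * frobSq B := by
  have h : frobSq A * frobSq B = ∑ i, ∑ k, (∑ j, A i j ^ 2) * ∑ j, B j k ^ 2 := by
    rw [← frobSq_transpose B]
    simp only [frobSq, Matrix.transpose_apply, Finset.sum_mul_sum]
  rw [h]
  unfold frobSq
  gcongr with i _ k _
  rw [Matrix.mul_apply]
  exact Finset.sum_mul_sq_le_sq_mul_sq _ _ _

theorem sq_apply_le_frobSq (A : Matrix (Fin a) (Fin b) ℝ) (i : Fin a) (j : Fin b) :
    A i j ^ 2 ≤ frobSq A :=
  (Finset.single_le_sum (f := fun j => A i j ^ 2) (fun _ _ => sq_nonneg _)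
    (Finset.mem_univ j)).trans
    (Finset.single_le_sum (f := fun i => ∑ j, A i j ^ 2)
      (fun _ _ => Finset.sum_nonneg fun _ _ => sq_nonneg _) (Finset.mem_univ i))

theorem frobSq_one : frobSq (1 : Matrix (Fin a) (Fin a) ℝ) = a := by
  rw [frobSq_eq_trace]; simp

theorem trace_mul_sq_le (A : Matrix (Fin a) (Fin b) ℝ) (B : Matrix (Fin b) (Fin a) ℝ) :
    (A * B).trace ^ 2 ≤ frobSq A * frobSq B := by
  have h1 : (A * B).trace = ∑ q : Fin a × Fin b, A q.1 q.2 * B q.2 q.1 := by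
    simp only [Matrix.trace, Matrix.diag, Matrix.mul_apply, Fintype.sum_prod_type]
  have h2 : frobSq A = ∑ q : Fin a × Fin b, A q.1 q.2 ^ 2 := by
    simp only [frobSq, Fintype.sum_prod_type]
  have h3 : frobSq B = ∑ q : Fin a × Fin b, B q.2 q.1 ^ 2 := by
    rw [← frobSq_transpose]
    simp only [frobSq, Fintype.sum_prod_type, Matrix.transpose_apply]
  rw [h1, h2, h3]
  exact Finset.sum_mul_sq_le_sq_mul_sq _ _ _

theorem frobSq_mul_of_orthogonal {x : ℝ} {U : Matrix (Fin a) (Fin b) ℝ}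
    (hU : Uᵀ * U = x • (1 : Matrix (Fin b) (Fin b) ℝ)) (G : Matrix (Fin b) (Fin c) ℝ) :
    frobSq (U * G) = x * frobSq G := by
  rw [frobSq_eq_trace, frobSq_eq_trace, Matrix.transpose_mul, Matrix.mul_assoc,
    ← Matrix.mul_assoc Uᵀ, hU]
  simp

theorem frobSq_add_of_orthogonal {A B : Matrix (Fin a) (Fin b) ℝ} (h : Aᵀ * B = 0) :
    frobSq (A + B) = frobSq A + frobSq B := by
  have h' : Bᵀ * A = 0 := by
    have := congrArg Matrix.transpose h
    simpa [Matrix.transpose_mul] using this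
  simp [frobSq_eq_trace, Matrix.add_mul, Matrix.mul_add, h, h']

/-- The traces of `H Hᵀ` and `Hᵀ H` and of their squares agree by cyclicity. The residual controls
`Hᵀ H - 1`, while the common components involve `H Hᵀ - 1`. -/
theorem frobSq_mul_transpose_sub_one (H : Matrix (Fin a) (Fin a) ℝ) :
    frobSq (H * Hᵀ - 1) = frobSq (Hᵀ * H - 1) := by
  have h : (H * Hᵀ * (H * Hᵀ)).trace = (Hᵀ * H * (Hᵀ * H)).trace := by
    rw [Matrix.mul_assoc, Matrix.trace_mul_comm]
    simp only [Matrix.mul_assoc]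
  have h' : (H * Hᵀ).trace = (Hᵀ * H).trace := Matrix.trace_mul_comm _ _
  simp [frobSq_eq_trace, Matrix.sub_mul, Matrix.mul_sub, Matrix.transpose_mul, h, h']

/-- The map `x ↦ P x` has squared operator norm at most `k`. -/
def OpBound (k : ℝ) (P : Matrix (Fin a) (Fin b) ℝ) : Prop :=
  ∀ x, (P *ᵥ x) ⬝ᵥ (P *ᵥ x) ≤ k * (x ⬝ᵥ x)

theorem dotProduct_sq_le (x y : Fin a → ℝ) : (x ⬝ᵥ y) ^ 2 ≤ (x ⬝ᵥ x) * (y ⬝ᵥ y) := by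
  simpa only [dotProduct, ← sq] using Finset.sum_mul_sq_le_sq_mul_sq Finset.univ x y

theorem dotProduct_self_nonneg' (x : Fin a → ℝ) : 0 ≤ x ⬝ᵥ x :=
  Finset.sum_nonneg fun _ _ => mul_self_nonneg _

theorem opBound_frobSq (A : Matrix (Fin a) (Fin b) ℝ) : OpBound (frobSq A) A := by
  intro x
  have := frobSq_mul_le A (Matrix.of fun i (_ : Fin 1) => x i)
  simpa [frobSq, Matrix.mul_apply, mulVec, dotProduct, sq] using this

theorem OpBound.frobSq_mul_le {k : ℝ} {P : Matrix (Fin a) (Fin b) ℝ} (hP : OpBound k P)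
    (G : Matrix (Fin b) (Fin c) ℝ) : frobSq (P * G) ≤ k * frobSq G := by
  rw [← frobSq_transpose, ← frobSq_transpose G]
  unfold frobSq
  rw [Finset.mul_sum]
  gcongr with j _
  have := hP fun i => G i j
  simpa [dotProduct, mulVec, Matrix.mul_apply, sq] using this

/-- By Cauchy–Schwarz `‖Pᵀx‖⁴ = ⟨x, P Pᵀx⟩² ≤ ‖x‖² · k ‖Pᵀx‖²`; cancel one factor `‖Pᵀx‖²`, unless
it vanishes. -/
theorem OpBound.transpose {k : ℝ} (hk : 0 ≤ k) {P : Matrix (Fin a) (Fin b) ℝ}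
    (hP : OpBound k P) : OpBound k Pᵀ := by
  intro x
  have h1 : (Pᵀ *ᵥ x) ⬝ᵥ (Pᵀ *ᵥ x) = x ⬝ᵥ (P *ᵥ (Pᵀ *ᵥ x)) := by
    rw [Matrix.dotProduct_mulVec x, Matrix.mulVec_transpose]
  have h2 := dotProduct_sq_le x (P *ᵥ (Pᵀ *ᵥ x))
  have h3 := hP (Pᵀ *ᵥ x)
  rw [← h1] at h2
  have hx := dotProduct_self_nonneg' x
  rcases (dotProduct_self_nonneg' (Pᵀ *ᵥ x)).eq_or_lt with h0 | h0
  · rw [← h0]; positivity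
  · have := mul_le_mul_of_nonneg_left h3 hx
    nlinarith

theorem OpBound.frobSq_mul_le_right {k : ℝ} (hk : 0 ≤ k) {P : Matrix (Fin b) (Fin c) ℝ}
    (hP : OpBound k P) (G : Matrix (Fin a) (Fin b) ℝ) : frobSq (G * P) ≤ k * frobSq G := by
  rw [← frobSq_transpose, Matrix.transpose_mul, ← frobSq_transpose G]
  exact (hP.transpose hk).frobSq_mul_le _

/-- The spectrum of `k • 1 - Pᵀ P` is `k` minus that of `Pᵀ P`, so this Hermitian matrix is positive
semidefinite. -/
theorem opBound_of_spectrum {k : ℝ} {P : Matrix (Fin a) (Fin a) ℝ}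
    (h : ∀ x ∈ spectrum ℝ (Pᵀ * P), x ≤ k) : OpBound k P := by
  have hH : (Pᵀ * P).IsHermitian := by
    simpa using Matrix.isHermitian_conjTranspose_mul_self P
  have hk : (k • (1 : Matrix (Fin a) (Fin a) ℝ) - Pᵀ * P).PosSemidef := by
    have hH' : (k • (1 : Matrix (Fin a) (Fin a) ℝ) - Pᵀ * P).IsHermitian :=
      Matrix.IsHermitian.sub (by simp [Matrix.IsHermitian]) hH
    rw [hH'.posSemidef_iff_eigenvalues_nonneg]
    have hs : ∀ e ∈ spectrum ℝ (k • (1 : Matrix (Fin a) (Fin a) ℝ) - Pᵀ * P), 0 ≤ e := by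
      intro e he
      rw [← Algebra.algebraMap_eq_smul_one, ← spectrum.singleton_sub_eq] at he
      obtain ⟨u, hu, v, hv, rfl⟩ := Set.mem_sub.1 he
      rw [Set.mem_singleton_iff.1 hu]
      exact sub_nonneg.2 (h v hv)
    exact fun i => hs _ (hH'.eigenvalues_mem_spectrum_real i)
  intro x
  have h1 := hk.dotProduct_mulVec_nonneg x
  have h2 : (P *ᵥ x) ⬝ᵥ (P *ᵥ x) = x ⬝ᵥ ((Pᵀ * P) *ᵥ x) := by
    rw [← Matrix.mulVec_mulVec, Matrix.dotProduct_mulVec x, Matrix.vecMul_transpose]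
  rw [h2]
  simp [Matrix.sub_mulVec, Matrix.smul_mulVec, dotProduct_sub] at h1
  linarith

end Frobenius

/-! ### The penalty matrix -/

section Penalty

variable {p : ℕ}

/-- Symmetrizing the quadratic form in `i` and `j` gives `2 xᵀ 𝓛 x = ∑ A i j (x i - x j)²`. -/
theorem posSemidef_laplacian {A : Matrix (Fin p) (Fin p) ℝ} (hA : IsAdjacency A) :
    (laplacian A).PosSemidef := by
  refine .of_dotProduct_mulVec_nonneg ?_ ?_
  · simp [Matrix.IsHermitian, laplacian, hA.symm.eq]
  · intro x
    have hs : ∀ i j, A j i = A i j := fun i j => hA.symm.apply i j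
    have h1 : x ⬝ᵥ (laplacian A *ᵥ x) = ∑ i, ∑ j, A i j * (x i ^ 2 - x i * x j) := by
      rw [laplacian, Matrix.sub_mulVec, dotProduct_sub]
      simp only [Matrix.mulVec_diagonal, dotProduct, degree]
      simp only [mulVec, dotProduct, ← Finset.sum_sub_distrib, Finset.mul_sum, Finset.sum_mul]
      refine Finset.sum_congr rfl fun i _ => Finset.sum_congr rfl fun j _ => by ring
    have h2 : x ⬝ᵥ (laplacian A *ᵥ x) = ∑ i, ∑ j, A i j * (x j ^ 2 - x i * x j) := by
      rw [h1, Finset.sum_comm]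
      refine Finset.sum_congr rfl fun i _ => Finset.sum_congr rfl fun j _ => by rw [hs]; ring
    have h3 : 2 * (x ⬝ᵥ (laplacian A *ᵥ x)) = ∑ i, ∑ j, A i j * (x i - x j) ^ 2 := by
      rw [two_mul]
      nth_rewrite 1 [h1]
      rw [h2]
      simp only [← Finset.sum_add_distrib]
      refine Finset.sum_congr rfl fun i _ => Finset.sum_congr rfl fun j _ => by ring
    have h4 : 0 ≤ ∑ i, ∑ j, A i j * (x i - x j) ^ 2 := by
      refine Finset.sum_nonneg fun i _ => Finset.sum_nonneg fun j _ => ?_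
      rcases hA.zero_or_one i j with h | h <;> rw [h] <;> positivity
    simp only [star_trivial]
    linarith

theorem posSemidef_normLaplacian {A : Matrix (Fin p) (Fin p) ℝ} (hA : IsAdjacency A) :
    (normLaplacian A).PosSemidef := by
  refine (posSemidef_laplacian hA).smul (inv_nonneg.2 ?_)
  refine mul_nonneg (by positivity) (Finset.sum_nonneg fun i _ => Finset.sum_nonneg fun j _ => ?_)
  rcases hA.zero_or_one i j with h | h <;> simp [h]

/-- What the estimation argument uses of the shrinkage matrix `K = D⁻¹`. -/
structure IsShrinkage (K : Matrix (Fin p) (Fin p) ℝ) : Prop where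
  symm : Kᵀ = K
  nonneg : ∀ x, 0 ≤ x ⬝ᵥ (K *ᵥ x)
  contraction : OpBound 1 K

theorem isShrinkage_inv {L : Matrix (Fin p) (Fin p) ℝ} (hL : L.PosSemidef) :
    IsShrinkage (1 + L)⁻¹ := by
  have hD : (1 + L).PosDef := Matrix.PosDef.one.add_posSemidef hL
  have hK : ((1 + L)⁻¹).PosDef := hD.inv
  refine ⟨by simpa [Matrix.IsHermitian] using hK.isHermitian, fun x => ?_, fun x => ?_⟩
  · simpa using hK.posSemidef.dotProduct_mulVec_nonneg x
  · have hdet : IsUnit (1 + L).det := (Matrix.isUnit_iff_isUnit_det _).1 hD.isUnit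
    -- With `x = y + L y`, `‖x‖² = ‖y‖² + 2⟨y, L y⟩ + ‖L y‖² ≥ ‖y‖²`.
    set y := (1 + L)⁻¹ *ᵥ x with hy
    have hx : x = y + L *ᵥ y := by
      have : (1 + L) *ᵥ y = x := by
        rw [hy, Matrix.mulVec_mulVec, Matrix.mul_nonsing_inv _ hdet, Matrix.one_mulVec]
      rw [← this, Matrix.add_mulVec, Matrix.one_mulVec]
    have h1 := hL.dotProduct_mulVec_nonneg y
    simp only [star_trivial] at h1
    have h2 := dotProduct_self_nonneg' (L *ᵥ y)
    rw [hx]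
    simp only [dotProduct_add, add_dotProduct, one_mul]
    rw [dotProduct_comm (L *ᵥ y) y]
    linarith

theorem isShrinkage_of_penalty {A D : Matrix (Fin p) (Fin p) ℝ} {α : ℝ} {m : ℕ}
    (hA : IsAdjacency A) (hα : 0 ≤ α)
    (hD : IsLaplacianPenalty A α D ∨ IsProjectionPenalty A α m D) : IsShrinkage D⁻¹ := by
  rcases hD with hD | ⟨-, U, -, hD⟩
  · rw [hD]
    exact isShrinkage_inv ((posSemidef_normLaplacian hA).smul hα)
  · rw [hD]
    refine isShrinkage_inv (Matrix.PosSemidef.smul ?_ hα)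
    simpa using Matrix.posSemidef_self_mul_conjTranspose U

variable {K : Matrix (Fin p) (Fin p) ℝ}

theorem IsShrinkage.trace_sq (hK : IsShrinkage K) : (K ^ 2).trace = frobSq K := by
  rw [frobSq_eq_trace, hK.symm, sq]

theorem IsShrinkage.frobSq_le (hK : IsShrinkage K) : frobSq K ≤ p := by
  have := hK.contraction.frobSq_mul_le (1 : Matrix (Fin p) (Fin p) ℝ)
  rwa [Matrix.mul_one, frobSq_one, one_mul] at this

end Penalty

/-! ### Deterministic analysis of the estimators -/

section Deterministic

variable {T p r : ℕ}

/-- A lower bound for the leading `r` eigenvalues from a lower bound of the quadratic form on an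
`r`-dimensional subspace. -/
theorem IsSpectralDecomposition.le_eigenvalue {G W : Matrix (Fin T) (Fin T) ℝ} {lam : Fin T → ℝ}
    (hG : IsSpectralDecomposition G W lam) {x κ : ℝ} (hx : 0 < x) {U : Matrix (Fin T) (Fin r) ℝ}
    (hU : Uᵀ * U = x • (1 : Matrix (Fin r) (Fin r) ℝ))
    (hκ : ∀ y, κ * ((U *ᵥ y) ⬝ᵥ (U *ᵥ y)) ≤ (U *ᵥ y) ⬝ᵥ (G *ᵥ (U *ᵥ y)))
    (hr : r ≤ T) (i : Fin r) : κ ≤ lam (Fin.castLE hr i) := by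
  by_contra! hlt
  have hiT : (i : ℕ) ≤ T := i.2.le.trans hr
  -- Courant–Fischer by dimension count: `i < r` linear conditions leave a nonzero `y` such that `U
  -- y` is orthogonal to the first `i` eigenvectors. On such a vector the form is at most the
  -- eigenvalue with zero-based index `i`.
  let f : (Fin r → ℝ) →ₗ[ℝ] (Fin i → ℝ) :=
    Matrix.mulVecLin ((Wᵀ * U).submatrix (Fin.castLE hiT) id)
  have hker : LinearMap.ker f ≠ ⊥ := LinearMap.ker_ne_bot_of_finrank_lt (by simp)
  obtain ⟨y, hy, hy0⟩ := Submodule.exists_mem_ne_zero_of_ne_bot hker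
  have hf : f y = 0 := hy
  set z := Wᵀ *ᵥ (U *ᵥ y) with hz
  have hz0 : ∀ j : Fin T, (j : ℕ) < i → z j = 0 := by
    intro j hj
    have := congrFun hf ⟨j, hj⟩
    rw [hz, Matrix.mulVec_mulVec]
    simpa [f, mulVec, dotProduct, Matrix.submatrix_apply] using this
  have hWW : W * Wᵀ = 1 := mul_eq_one_comm.1 hG.orthogonal
  have h1 : (U *ᵥ y) ⬝ᵥ (U *ᵥ y) = z ⬝ᵥ z := by
    rw [hz, Matrix.dotProduct_mulVec (Wᵀ *ᵥ _), Matrix.vecMul_transpose, Matrix.mulVec_mulVec,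
      hWW, Matrix.one_mulVec]
  have h2 : (U *ᵥ y) ⬝ᵥ (G *ᵥ (U *ᵥ y)) = ∑ j, lam j * z j ^ 2 := by
    rw [hG.eq_mul, ← Matrix.mulVec_mulVec, ← Matrix.mulVec_mulVec, Matrix.dotProduct_mulVec,
      ← Matrix.mulVec_transpose, ← hz]
    simp only [dotProduct, Matrix.mulVec_diagonal]
    exact Finset.sum_congr rfl fun j _ => by ring
  have h3 : (U *ᵥ y) ⬝ᵥ (U *ᵥ y) = x * (y ⬝ᵥ y) := by
    rw [Matrix.dotProduct_mulVec, ← Matrix.mulVec_transpose, Matrix.mulVec_mulVec, hU]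
    simp [Matrix.smul_mulVec, smul_dotProduct]
  have hpos : 0 < z ⬝ᵥ z := by
    rw [← h1, h3]
    refine mul_pos hx (lt_of_le_of_ne (dotProduct_self_nonneg' y) fun h => hy0 ?_)
    exact dotProduct_self_eq_zero.1 h.symm
  have h4 : ∑ j, lam j * z j ^ 2 ≤ lam (Fin.castLE hr i) * (z ⬝ᵥ z) := by
    rw [dotProduct, Finset.mul_sum]
    refine Finset.sum_le_sum fun j _ => ?_
    rcases lt_or_ge (j : ℕ) i with h | h
    · simp [hz0 j h]
    · rw [← sq]
      exact mul_le_mul_of_nonneg_right (hG.antitone (by simpa [Fin.le_def] using h)) (sq_nonneg _)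
  have h5 := hκ y
  rw [h1, h2] at h5
  have := mul_lt_mul_of_pos_right hlt hpos
  linarith

/-- The deterministic conditions on a sample which the error bounds for the estimators need;
`K` is the shrinkage matrix. -/
structure IsRegularSample (k c : ℝ) (F : Matrix (Fin T) (Fin r) ℝ) (B : Matrix (Fin p) (Fin r) ℝ)
    (E : Matrix (Fin T) (Fin p) ℝ) (K : Matrix (Fin p) (Fin p) ℝ)
    (Fhat : Matrix (Fin T) (Fin r) ℝ) : Prop where
  shrinkage : IsShrinkage K
  loadings : frobSq B ≤ k * p
  informative : ∀ y, c * (y ⬝ᵥ y) ≤ y ⬝ᵥ (((p : ℝ)⁻¹ • (Bᵀ * K * B)) *ᵥ y)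
  normalized : (T : ℝ)⁻¹ • (Fᵀ * F) = 1
  estimator : ∃ V : Matrix (Fin T) (Fin r) ℝ,
    IsLeadingEigenvectors (((p : ℝ) * T)⁻¹ • (data F B E * K * (data F B E)ᵀ)) V ∧
      Fhat = √(T : ℝ) • V
  noise_loadings : frobSq (E * K * B) ≤ k * T * p
  noise_factors : frobSq (K * Eᵀ * F) ≤ k * T * frobSq K
  noise : frobSq (K * Eᵀ) ≤ k * T * frobSq K
  -- The term `T ^ 2` accounts for the fluctuation of the quadratic form, `p` for the square of the
  -- trace around which it concentrates.
  noise_quadratic : ∀ G : Matrix (Fin T) (Fin r) ℝ,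
    frobSq (E * K * Eᵀ * G) ≤ k * ((T : ℝ) ^ 2 + p) * frobSq K * frobSq G

/-- The coefficients of the regression of the estimated scores on the factor scores. -/
noncomputable def rotation (F Fhat : Matrix (Fin T) (Fin r) ℝ) : Matrix (Fin r) (Fin r) ℝ :=
  (T : ℝ)⁻¹ • (Fᵀ * Fhat)

theorem data_quadratic {K : Matrix (Fin p) (Fin p) ℝ} (hK : Kᵀ = K)
    (F : Matrix (Fin T) (Fin r) ℝ) (B : Matrix (Fin p) (Fin r) ℝ) (E : Matrix (Fin T) (Fin p) ℝ) :
    data F B E * K * (data F B E)ᵀ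
      = F * (Bᵀ * K * B) * Fᵀ + F * (E * K * B)ᵀ + (E * K * B) * Fᵀ + E * K * Eᵀ := by
  simp only [data, common, Matrix.transpose_add, Matrix.transpose_mul, Matrix.transpose_transpose,
    Matrix.add_mul, Matrix.mul_add, hK, Matrix.mul_assoc]
  abel

section RegularSample

variable {k c : ℝ} {F : Matrix (Fin T) (Fin r) ℝ} {B : Matrix (Fin p) (Fin r) ℝ}
  {E : Matrix (Fin T) (Fin p) ℝ} {K : Matrix (Fin p) (Fin p) ℝ} {Fhat : Matrix (Fin T) (Fin r) ℝ}

namespace IsRegularSample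

theorem gram_factors (h : IsRegularSample k c F B E K Fhat) (hT : 0 < T) :
    Fᵀ * F = (T : ℝ) • (1 : Matrix (Fin r) (Fin r) ℝ) := by
  rw [← h.normalized, smul_smul, mul_inv_cancel₀ (by positivity), one_smul]

theorem gram_scores (h : IsRegularSample k c F B E K Fhat) :
    Fhatᵀ * Fhat = (T : ℝ) • (1 : Matrix (Fin r) (Fin r) ℝ) := by
  obtain ⟨V, ⟨hk, W, lam, hW, hV⟩, hF⟩ := h.estimator
  have hVV : Vᵀ * V = 1 := by
    rw [hV, Matrix.transpose_submatrix,
      ← Matrix.submatrix_mul Wᵀ W _ id _ Function.bijective_id, hW.orthogonal]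
    exact Matrix.submatrix_one _ (Fin.castLE_injective hk)
  rw [hF, Matrix.transpose_smul, Matrix.smul_mul, Matrix.mul_smul, smul_smul, hVV,
    Real.mul_self_sqrt (by positivity)]

theorem frobSq_scores (h : IsRegularSample k c F B E K Fhat) : frobSq Fhat = T * r := by
  rw [frobSq_eq_trace, h.gram_scores]; simp

theorem transpose_mul_residual (h : IsRegularSample k c F B E K Fhat) (hT : 0 < T) :
    Fᵀ * (Fhat - F * rotation F Fhat) = 0 := by
  rw [Matrix.mul_sub, ← Matrix.mul_assoc, h.gram_factors hT, rotation, Matrix.smul_mul,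
    Matrix.one_mul, smul_smul, mul_inv_cancel₀ (by positivity), one_smul, sub_self]

/-- Pythagoras. It allows the residual to be bounded through whichever coefficient matrix the
eigenvector equation supplies. -/
theorem frobSq_residual_le_of_coefficients (h : IsRegularSample k c F B E K Fhat) (hT : 0 < T)
    (H : Matrix (Fin r) (Fin r) ℝ) :
    frobSq (Fhat - F * rotation F Fhat) ≤ frobSq (Fhat - F * H) := by
  have h1 : Fhat - F * H
      = (Fhat - F * rotation F Fhat) + F * (rotation F Fhat - H) := by
    rw [Matrix.mul_sub]; abel
  rw [h1, frobSq_add_of_orthogonal]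
  · exact le_add_of_nonneg_right (frobSq_nonneg _)
  · have := congrArg Matrix.transpose (h.transpose_mul_residual hT)
    rw [Matrix.transpose_mul, Matrix.transpose_transpose, Matrix.transpose_zero] at this
    rw [← Matrix.mul_assoc, this, Matrix.zero_mul]

theorem frobSq_rotation_le (h : IsRegularSample k c F B E K Fhat) (hT : 0 < T) :
    frobSq (rotation F Fhat) ≤ r := by
  have h1 : Fhat = F * rotation F Fhat + (Fhat - F * rotation F Fhat) := by abel
  have h2 : frobSq Fhat = T * frobSq (rotation F Fhat)
      + frobSq (Fhat - F * rotation F Fhat) := by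
    nth_rewrite 1 [h1]
    rw [frobSq_add_of_orthogonal, frobSq_mul_of_orthogonal (h.gram_factors hT)]
    rw [Matrix.transpose_mul, Matrix.mul_assoc, h.transpose_mul_residual hT, Matrix.mul_zero]
  rw [h.frobSq_scores] at h2
  have hT' : (0 : ℝ) < T := by exact_mod_cast hT
  have := frobSq_nonneg (Fhat - F * rotation F Fhat)
  nlinarith

theorem frobSq_residual_le_mul (h : IsRegularSample k c F B E K Fhat) (hT : 0 < T) :
    frobSq (Fhat - F * rotation F Fhat) ≤ T * r := by
  have := h.frobSq_residual_le_of_coefficients hT 0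
  rwa [Matrix.mul_zero, sub_zero, h.frobSq_scores] at this

/-- Both `F` and `Fhat` have Gram matrix `T I`, so the defect of `H` from orthogonality is precisely
the Gram matrix of the residual. It is therefore quadratic in the score error. -/
theorem rotation_gram (h : IsRegularSample k c F B E K Fhat) (hT : 0 < T) :
    (rotation F Fhat)ᵀ * rotation F Fhat - 1 = -((T : ℝ)⁻¹ •
      ((Fhat - F * rotation F Fhat)ᵀ * (Fhat - F * rotation F Fhat))) := by
  have hT' : (T : ℝ) ≠ 0 := by positivity
  have h1 : (Fhat - F * rotation F Fhat)ᵀ * (Fhat - F * rotation F Fhat)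
      = Fhatᵀ * Fhat - (T : ℝ) • ((rotation F Fhat)ᵀ * rotation F Fhat) := by
    rw [Matrix.transpose_sub, Matrix.sub_mul, Matrix.transpose_mul, Matrix.mul_assoc,
      h.transpose_mul_residual hT, Matrix.mul_zero, sub_zero, Matrix.mul_sub, ← Matrix.mul_assoc]
    congr 1
    simp [rotation, Matrix.transpose_smul, Matrix.transpose_mul, smul_smul, hT']
  rw [h1, h.gram_scores, smul_sub, smul_smul, smul_smul, inv_mul_cancel₀ hT', one_smul, one_smul]
  abel

theorem frobSq_rotation_gram_le (h : IsRegularSample k c F B E K Fhat) (hT : 0 < T) :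
    frobSq ((rotation F Fhat)ᵀ * rotation F Fhat - 1)
      ≤ ((T : ℝ)⁻¹ * frobSq (Fhat - F * rotation F Fhat)) ^ 2 := by
  rw [h.rotation_gram hT, ← neg_one_smul ℝ, smul_smul, frobSq_smul, mul_pow, mul_pow]
  have := NFM.frobSq_mul_le (Fhat - F * rotation F Fhat)ᵀ (Fhat - F * rotation F Fhat)
  rw [frobSq_transpose] at this
  rw [neg_one_sq, one_mul, sq (frobSq _)]
  exact mul_le_mul_of_nonneg_left this (by positivity)

/-- At `x = F y` the signal contributes at least `c`, the noise form is nonnegative, and each of the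
two cross terms costs at most `c / 4`. The condition on `p` is what yields `c / 4`. -/
theorem le_quadratic (h : IsRegularSample k c F B E K Fhat) (hc : 0 < c) (hT : 0 < T) (hp : 0 < p)
    (hpk : 16 * k ≤ c ^ 2 * p) (y : Fin r → ℝ) :
    c / 2 * ((F *ᵥ y) ⬝ᵥ (F *ᵥ y)) ≤ (F *ᵥ y) ⬝ᵥ
      ((((p : ℝ) * T)⁻¹ • (data F B E * K * (data F B E)ᵀ)) *ᵥ (F *ᵥ y)) := by
  have hT' : (0 : ℝ) < T := by exact_mod_cast hT
  have hp' : (0 : ℝ) < p := by exact_mod_cast hp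
  set x := F *ᵥ y with hx
  have hFx : Fᵀ *ᵥ x = (T : ℝ) • y := by
    rw [hx, Matrix.mulVec_mulVec, h.gram_factors hT, Matrix.smul_mulVec, Matrix.one_mulVec]
  have hxx : x ⬝ᵥ x = T * (y ⬝ᵥ y) := by
    nth_rewrite 2 [hx]
    rw [Matrix.dotProduct_mulVec, ← Matrix.mulVec_transpose, hFx]
    simp [smul_dotProduct]
  set Y := E * K * B with hY
  have h1 : (x ⬝ᵥ (Y *ᵥ y)) ^ 2 ≤ (c / 4 * (p * T * (y ⬝ᵥ y))) ^ 2 := by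
    have e1 := dotProduct_sq_le x (Y *ᵥ y)
    have e2 := opBound_frobSq Y y
    have e3 : frobSq Y * (y ⬝ᵥ y) ≤ k * T * p * (y ⬝ᵥ y) :=
      mul_le_mul_of_nonneg_right h.noise_loadings (dotProduct_self_nonneg' y)
    have hy := dotProduct_self_nonneg' y
    calc _ ≤ _ := e1
      _ ≤ (T * (y ⬝ᵥ y)) * (k * T * p * (y ⬝ᵥ y)) := by
        rw [hxx]; exact mul_le_mul_of_nonneg_left (e2.trans e3) (by positivity)
      _ = (k * p) * (T * (y ⬝ᵥ y)) ^ 2 := by ring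
      _ ≤ (c ^ 2 * p / 16 * p) * (T * (y ⬝ᵥ y)) ^ 2 := by gcongr; linarith
      _ = _ := by ring
  have h2 : -(c / 4 * (p * T * (y ⬝ᵥ y))) ≤ x ⬝ᵥ (Y *ᵥ y) :=
    (abs_le_of_sq_le_sq' h1 (by have := dotProduct_self_nonneg' y; positivity)).1
  have h3 : 0 ≤ x ⬝ᵥ ((E * K * Eᵀ) *ᵥ x) := by
    have := h.shrinkage.nonneg (Eᵀ *ᵥ x)
    rwa [Matrix.mulVec_transpose, ← Matrix.mulVec_transpose, dotProduct_comm,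
      Matrix.dotProduct_mulVec, ← Matrix.mulVec_transpose, Matrix.transpose_transpose,
      dotProduct_comm, Matrix.mulVec_mulVec, Matrix.mulVec_mulVec] at this
  have h4 : x ⬝ᵥ ((F * (Bᵀ * K * B) * Fᵀ) *ᵥ x) = T ^ 2 * (y ⬝ᵥ ((Bᵀ * K * B) *ᵥ y)) := by
    rw [← Matrix.mulVec_mulVec, hFx, ← Matrix.mulVec_mulVec, Matrix.dotProduct_mulVec,
      ← Matrix.mulVec_transpose, hFx, Matrix.mulVec_smul]
    simp only [smul_dotProduct, dotProduct_smul, smul_eq_mul]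
    ring
  have h5 : x ⬝ᵥ ((Y * Fᵀ) *ᵥ x) = T * (x ⬝ᵥ (Y *ᵥ y)) := by
    rw [← Matrix.mulVec_mulVec, hFx, Matrix.mulVec_smul]
    simp only [dotProduct_smul, smul_eq_mul]
  have h6 : x ⬝ᵥ ((F * Yᵀ) *ᵥ x) = T * (x ⬝ᵥ (Y *ᵥ y)) := by
    rw [← h5, Matrix.dotProduct_mulVec, ← Matrix.mulVec_transpose, Matrix.transpose_mul,
      Matrix.transpose_transpose, dotProduct_comm]
  have h7 := h.informative y
  rw [Matrix.smul_mulVec, dotProduct_smul, smul_eq_mul] at h7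
  have h7' : c * (y ⬝ᵥ y) * p ≤ y ⬝ᵥ ((Bᵀ * K * B) *ᵥ y) := by
    rwa [← div_eq_inv_mul, le_div_iff₀ hp'] at h7
  rw [data_quadratic h.shrinkage.symm, Matrix.smul_mulVec, dotProduct_smul, smul_eq_mul,
    ← div_eq_inv_mul, le_div_iff₀ (by positivity), Matrix.add_mulVec, Matrix.add_mulVec,
    Matrix.add_mulVec, dotProduct_add, dotProduct_add, dotProduct_add, h4, h5, h6, hxx]
  have e1 := mul_le_mul_of_nonneg_left h7' (by positivity : (0 : ℝ) ≤ T ^ 2)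
  have e2 := mul_le_mul_of_nonneg_left h2 hT'.le
  nlinarith

/-- The error bound for the estimated scores. -/
theorem frobSq_residual_le (h : IsRegularSample k c F B E K Fhat) (hk : 0 ≤ k) (hc : 0 < c)
    (hT : 0 < T) (hp : 0 < p) (hpk : 16 * k ≤ c ^ 2 * p) :
    (T : ℝ)⁻¹ * frobSq (Fhat - F * rotation F Fhat)
      ≤ 16 * r * k / c ^ 2 * (1 / p + frobSq K / (p * (T : ℝ) ^ 2)) := by
  have hT' : (0 : ℝ) < T := by exact_mod_cast hT
  have hp' : (0 : ℝ) < p := by exact_mod_cast hp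
  obtain ⟨V, ⟨hr, W, lam, hW, hV⟩, hF⟩ := h.estimator
  have hlam : ∀ i : Fin r, c / 2 ≤ lam (Fin.castLE hr i) :=
    hW.le_eigenvalue hT' (h.gram_factors hT) (h.le_quadratic hc hT hp hpk) hr
  set G := ((p : ℝ) * T)⁻¹ • (data F B E * K * (data F B E)ᵀ) with hG
  set Λ : Matrix (Fin r) (Fin r) ℝ := Matrix.diagonal fun i => lam (Fin.castLE hr i) with hΛ
  set Λ' : Matrix (Fin r) (Fin r) ℝ := Matrix.diagonal fun i => (lam (Fin.castLE hr i))⁻¹ with hΛ'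
  have hpos : ∀ i : Fin r, 0 < lam (Fin.castLE hr i) := fun i => by linarith [hlam i]
  have hΛΛ : Λ * Λ' = 1 := by
    rw [hΛ, hΛ', Matrix.diagonal_mul_diagonal, ← Matrix.diagonal_one]
    congr 1
    ext i
    exact mul_inv_cancel₀ (hpos i).ne'
  have hGW : G * W = W * Matrix.diagonal lam := by
    rw [hW.eq_mul, Matrix.mul_assoc, hW.orthogonal, Matrix.mul_one]
  have hGV : G * V = V * Λ := by
    ext t i
    have := congrFun (congrFun hGW t) (Fin.castLE hr i)
    rw [Matrix.mul_diagonal] at this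
    rw [hΛ, Matrix.mul_diagonal, hV]
    simpa [Matrix.mul_apply] using this
  have hGF : G * Fhat * Λ' = Fhat := by
    rw [hF, Matrix.mul_smul, hGV, Matrix.smul_mul, Matrix.mul_assoc, hΛΛ, Matrix.mul_one]
  have hΛb : OpBound (4 / c ^ 2) Λ' := by
    intro y
    rw [dotProduct, dotProduct, Finset.mul_sum]
    refine Finset.sum_le_sum fun i _ => ?_
    rw [hΛ', Matrix.mulVec_diagonal]
    have e1 : (lam (Fin.castLE hr i))⁻¹ ≤ 2 / c := by
      rw [inv_le_comm₀ (hpos i) (by positivity)]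
      simpa using hlam i
    have e2 : (lam (Fin.castLE hr i))⁻¹ ^ 2 ≤ (2 / c) ^ 2 :=
      pow_le_pow_left₀ (inv_pos.2 (hpos i)).le e1 2
    have e3 : (2 / c) ^ 2 = 4 / c ^ 2 := by rw [div_pow]; norm_num
    rw [e3] at e2
    nlinarith [mul_le_mul_of_nonneg_right e2 (mul_self_nonneg (y i))]
  set Y := E * K * B with hY
  set q := frobSq K with hq
  have hqp : q ≤ p := h.shrinkage.frobSq_le
  have hq0 : 0 ≤ q := frobSq_nonneg _
  -- Substitute `Fhat = G Fhat Λ⁻¹` and choose the coefficients so that every term with `F` as its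
  -- left factor cancels.
  have hdecomp : Fhat - F * (((p : ℝ) * T)⁻¹ • (((Bᵀ * K * B) * Fᵀ + Yᵀ) * Fhat * Λ'))
      = ((p : ℝ) * T)⁻¹ • ((Y * (Fᵀ * Fhat) + E * K * Eᵀ * Fhat) * Λ') := by
    nth_rewrite 1 [← hGF]
    rw [hG, data_quadratic h.shrinkage.symm, ← hY, Matrix.smul_mul, Matrix.smul_mul, Matrix.mul_smul,
      ← smul_sub]
    congr 1
    simp only [Matrix.add_mul, Matrix.mul_add, Matrix.mul_assoc]
    abel
  have h1 := h.frobSq_residual_le_of_coefficients hT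
    (((p : ℝ) * T)⁻¹ • (((Bᵀ * K * B) * Fᵀ + Yᵀ) * Fhat * Λ'))
  rw [hdecomp, frobSq_smul] at h1
  have h2 := hΛb.frobSq_mul_le_right (by positivity) (Y * (Fᵀ * Fhat) + E * K * Eᵀ * Fhat)
  have h3 := frobSq_add_le (Y * (Fᵀ * Fhat)) (E * K * Eᵀ * Fhat)
  have h4 : frobSq (Y * (Fᵀ * Fhat)) ≤ k * T * p * (T ^ 2 * r) := by
    refine (NFM.frobSq_mul_le _ _).trans ?_
    have : Fᵀ * Fhat = (T : ℝ) • rotation F Fhat := by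
      rw [rotation, smul_smul, mul_inv_cancel₀ hT'.ne', one_smul]
    rw [this, frobSq_smul]
    have e := h.frobSq_rotation_le hT
    exact mul_le_mul h.noise_loadings (by gcongr)
      (mul_nonneg (by positivity) (frobSq_nonneg _)) (by positivity)
  have h5 := h.noise_quadratic Fhat
  rw [h.frobSq_scores, ← hq] at h5
  have h6 : frobSq ((Y * (Fᵀ * Fhat) + E * K * Eᵀ * Fhat) * Λ')
      ≤ 4 / c ^ 2 * (2 * (k * T * p * (T ^ 2 * r) + k * ((T : ℝ) ^ 2 + p) * q * (T * r))) := by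
    refine h2.trans (mul_le_mul_of_nonneg_left (h3.trans ?_) (by positivity))
    gcongr
  calc (T : ℝ)⁻¹ * frobSq (Fhat - F * rotation F Fhat)
      ≤ (T : ℝ)⁻¹ * (((p : ℝ) * T)⁻¹ ^ 2 * (4 / c ^ 2 * (2 * (k * T * p * (T ^ 2 * r)
          + k * ((T : ℝ) ^ 2 + p) * q * (T * r))))) := by gcongr; exact h1.trans (by gcongr)
    -- The three summands come from the cross term, the fluctuation of the noise form and its trace
    -- part. Since `q ≤ p`, the second is absorbed by the first.
    _ = 8 * r * k / c ^ 2 * (1 / p + q / p * (1 / p) + q / (p * (T : ℝ) ^ 2)) := by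
        field_simp
        ring
    _ ≤ 8 * r * k / c ^ 2 * (1 / p + 1 * (1 / p) + q / (p * (T : ℝ) ^ 2)) := by
        gcongr
        exact (div_le_one hp').2 hqp
    _ ≤ 8 * r * k / c ^ 2 * (2 * (1 / p + q / (p * (T : ℝ) ^ 2))) := by
        gcongr
        have : 0 ≤ q / (p * (T : ℝ) ^ 2) := by positivity
        linarith
    _ = _ := by ring


/-- `Fhat` depends on the noise, so `Eᵀ Fhat` is split: independence of noise and factors is
available for `Eᵀ F`, while `Eᵀ (Fhat - F H)` is handled by the smallness of the residual. -/
theorem loading_error_eq :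
    (T : ℝ)⁻¹ • (K * (data F B E)ᵀ * Fhat) - B * rotation F Fhat
      = (K - 1) * B * rotation F Fhat + (T : ℝ)⁻¹ • (K * Eᵀ * F * rotation F Fhat)
        + (T : ℝ)⁻¹ • (K * Eᵀ * (Fhat - F * rotation F Fhat)) := by
  have h1 : K * (data F B E)ᵀ * Fhat = K * B * (Fᵀ * Fhat) + K * Eᵀ * Fhat := by
    simp only [data, common, Matrix.transpose_add, Matrix.transpose_mul,
      Matrix.transpose_transpose, Matrix.add_mul, Matrix.mul_add, Matrix.mul_assoc]
  have h2 : (T : ℝ)⁻¹ • (K * B * (Fᵀ * Fhat)) = K * B * rotation F Fhat := by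
    rw [rotation, Matrix.mul_smul]
  rw [h1, smul_add, h2, Matrix.mul_sub, smul_sub, Matrix.sub_mul, Matrix.sub_mul, Matrix.one_mul,
    ← Matrix.mul_assoc (K * Eᵀ)]
  abel

/-- The error bound for the estimated loadings. -/
theorem frobSq_loading_error_le (h : IsRegularSample k c F B E K Fhat) (hk : 0 ≤ k)
    (hT : 0 < T) {x : ℝ} (hx : frobSq (Fhat - F * rotation F Fhat) ≤ x) :
    (p : ℝ)⁻¹ * frobSq ((T : ℝ)⁻¹ • (K * (data F B E)ᵀ * Fhat) - B * rotation F Fhat)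
      ≤ 3 * (r + k * r + k * x) *
        ((p : ℝ)⁻¹ * frobSq ((K - 1) * B) + frobSq K / (p * T)) := by
  rcases Nat.eq_zero_or_pos p with rfl | hp
  · simp
  have hT' : (0 : ℝ) < T := by exact_mod_cast hT
  have hp' : (0 : ℝ) < p := by exact_mod_cast hp
  have hx0 : 0 ≤ x := (frobSq_nonneg _).trans hx
  set q := frobSq K with hq
  have hq0 : 0 ≤ q := frobSq_nonneg _
  set b := frobSq ((K - 1) * B) with hb
  have hb0 : 0 ≤ b := frobSq_nonneg _
  have hH := h.frobSq_rotation_le hT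
  have hH0 := frobSq_nonneg (rotation F Fhat)
  have h1 : frobSq ((K - 1) * B * rotation F Fhat) ≤ b * r :=
    (NFM.frobSq_mul_le _ _).trans (by gcongr)
  have h2 : frobSq ((T : ℝ)⁻¹ • (K * Eᵀ * F * rotation F Fhat))
      ≤ (T : ℝ)⁻¹ ^ 2 * (k * T * q * r) := by
    rw [frobSq_smul]
    gcongr
    exact (NFM.frobSq_mul_le _ _).trans (mul_le_mul h.noise_factors hH hH0 (by positivity))
  have h3 : frobSq ((T : ℝ)⁻¹ • (K * Eᵀ * (Fhat - F * rotation F Fhat)))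
      ≤ (T : ℝ)⁻¹ ^ 2 * (k * T * q * x) := by
    rw [frobSq_smul]
    gcongr
    exact (NFM.frobSq_mul_le _ _).trans
      (mul_le_mul h.noise hx (frobSq_nonneg _) (by positivity))
  rw [loading_error_eq]
  calc (p : ℝ)⁻¹ * _ ≤ (p : ℝ)⁻¹ * (3 * (b * r + (T : ℝ)⁻¹ ^ 2 * (k * T * q * r)
        + (T : ℝ)⁻¹ ^ 2 * (k * T * q * x))) := by
        gcongr
        exact (frobSq_add_add_le _ _ _).trans (by gcongr)
    _ = 3 * (r * ((p : ℝ)⁻¹ * b) + (k * r + k * x) * (q / (p * T))) := by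
        field_simp
        ring
    _ ≤ 3 * ((r + k * r + k * x) * ((p : ℝ)⁻¹ * b) + (r + k * r + k * x) * (q / (p * T))) := by
        gcongr
        · have : 0 ≤ k * r + k * x := by positivity
          linarith
        · have : (0 : ℝ) ≤ r := by positivity
          linarith
    _ = _ := by ring

/-- The error bound for the estimated common components. -/
theorem frobSq_common_error_le (h : IsRegularSample k c F B E K Fhat) (hk : 0 ≤ k)
    (hT : 0 < T) (Bhat : Matrix (Fin p) (Fin r) ℝ) :
    ((p : ℝ) * T)⁻¹ * frobSq (common Fhat Bhat - common F B)
      ≤ 3 * ((p : ℝ)⁻¹ * frobSq (Bhat - B * rotation F Fhat)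
        + 2 * r * k * ((T : ℝ)⁻¹ * frobSq (Fhat - F * rotation F Fhat))) := by
  rcases Nat.eq_zero_or_pos p with rfl | hp
  · have := frobSq_nonneg (Fhat - F * rotation F Fhat)
    simp
    positivity
  have hT' : (0 : ℝ) < T := by exact_mod_cast hT
  have hp' : (0 : ℝ) < p := by exact_mod_cast hp
  set H := rotation F Fhat with hH
  set R := Fhat - F * H with hR
  have hR0 := frobSq_nonneg R
  have hdecomp : common Fhat Bhat - common F B
      = Fhat * (Bhat - B * H)ᵀ + R * Hᵀ * Bᵀ + F * ((H * Hᵀ - 1) * Bᵀ) := by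
    simp only [common, hR, Matrix.transpose_sub, Matrix.transpose_mul, Matrix.mul_sub,
      Matrix.sub_mul, Matrix.one_mul, Matrix.mul_assoc]
    abel
  have h1 : frobSq (Fhat * (Bhat - B * H)ᵀ) = T * frobSq (Bhat - B * H) := by
    rw [frobSq_mul_of_orthogonal h.gram_scores, frobSq_transpose]
  have h2 : frobSq (R * Hᵀ * Bᵀ) ≤ frobSq R * r * (k * p) := by
    refine (NFM.frobSq_mul_le _ _).trans ?_
    rw [frobSq_transpose]
    refine mul_le_mul ((NFM.frobSq_mul_le _ _).trans ?_) h.loadings (frobSq_nonneg _)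
      (by positivity)
    rw [frobSq_transpose]
    exact mul_le_mul_of_nonneg_left (h.frobSq_rotation_le hT) hR0
  have h3 : frobSq (F * ((H * Hᵀ - 1) * Bᵀ)) ≤ T * ((T : ℝ)⁻¹ * frobSq R * r * (k * p)) := by
    rw [frobSq_mul_of_orthogonal (h.gram_factors hT)]
    gcongr
    refine (NFM.frobSq_mul_le _ _).trans ?_
    rw [frobSq_transpose, frobSq_mul_transpose_sub_one]
    refine mul_le_mul ((h.frobSq_rotation_gram_le hT).trans ?_) h.loadings (frobSq_nonneg _)
      (by positivity)
    -- One of the two factors `T⁻¹ ‖R‖²` is bounded by `r`, so the quadratic defect of `H` costs no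
    -- more than the score error.
    rw [sq]
    gcongr
    rw [← div_eq_inv_mul, div_le_iff₀ hT', mul_comm]
    exact h.frobSq_residual_le_mul hT
  rw [hdecomp]
  calc ((p : ℝ) * T)⁻¹ * _ ≤ ((p : ℝ) * T)⁻¹ * (3 * (T * frobSq (Bhat - B * H)
        + frobSq R * r * (k * p) + T * ((T : ℝ)⁻¹ * frobSq R * r * (k * p)))) := by
        gcongr
        refine (frobSq_add_add_le _ _ _).trans ?_
        rw [h1]
        gcongr
    _ = _ := by
        field_simp
        ring

end IsRegularSample
end RegularSample
end Deterministic
/-! ### Moment bounds -/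

section Moments

variable {Ω : Type*} [MeasurableSpace Ω] {μ : Measure Ω} {S : Type*}

theorem memLp_sum_mul {s : Finset S} {Y : S → Ω → ℝ} (hY : ∀ q ∈ s, MemLp (Y q) 2 μ) (a : S → ℝ) :
    MemLp (fun ω => ∑ q ∈ s, a q * Y q ω) 2 μ :=
  memLp_finsetSum _ fun q hq => (hY q hq).const_mul (a q)

theorem integral_sum_sq_of_orthogonal {s : Finset S} {Y : S → Ω → ℝ}
    (hY : ∀ q ∈ s, MemLp (Y q) 2 μ)
    (h : ∀ q ∈ s, ∀ q' ∈ s, q ≠ q' → ∫ ω, Y q ω * Y q' ω ∂μ = 0) (a : S → ℝ) :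
    ∫ ω, (∑ q ∈ s, a q * Y q ω) ^ 2 ∂μ = ∑ q ∈ s, a q ^ 2 * ∫ ω, Y q ω ^ 2 ∂μ := by
  have h1 : ∀ q ∈ s, ∀ q' ∈ s, Integrable (fun ω => a q * a q' * (Y q ω * Y q' ω)) μ :=
    fun q hq q' hq' => ((hY q hq).integrable_mul (hY q' hq')).const_mul _
  have h2 : ∀ ω, (∑ q ∈ s, a q * Y q ω) ^ 2
      = ∑ q ∈ s, ∑ q' ∈ s, a q * a q' * (Y q ω * Y q' ω) := by
    intro ω
    rw [sq, Finset.sum_mul_sum]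
    exact Finset.sum_congr rfl fun q _ => Finset.sum_congr rfl fun q' _ => by ring
  simp_rw [h2]
  rw [integral_finsetSum _ fun q hq => integrable_finsetSum _ fun q' hq' => h1 q hq q' hq']
  refine Finset.sum_congr rfl fun q hq => ?_
  rw [integral_finsetSum _ fun q' hq' => h1 q hq q' hq', Finset.sum_eq_single q]
  · rw [integral_const_mul]
    simp only [sq]
  · intro q' hq' hne
    rw [integral_const_mul, h q hq q' hq' hne.symm, mul_zero]
  · exact fun hq' => absurd hq hq'

theorem integral_sum_sq_le_of_orthogonal {s : Finset S} {Y : S → Ω → ℝ}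
    (hY : ∀ q ∈ s, MemLp (Y q) 2 μ)
    (h : ∀ q ∈ s, ∀ q' ∈ s, q ≠ q' → ∫ ω, Y q ω * Y q' ω ∂μ = 0) {M : ℝ}
    (hM : ∀ q ∈ s, ∫ ω, Y q ω ^ 2 ∂μ ≤ M) (a : S → ℝ) :
    ∫ ω, (∑ q ∈ s, a q * Y q ω) ^ 2 ∂μ ≤ M * ∑ q ∈ s, a q ^ 2 := by
  rw [integral_sum_sq_of_orthogonal hY h, Finset.mul_sum]
  refine Finset.sum_le_sum fun q hq => ?_
  rw [mul_comm]
  exact mul_le_mul_of_nonneg_right (hM q hq) (sq_nonneg _)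

theorem integrable_frobSq {a b : ℕ} {A : Ω → Matrix (Fin a) (Fin b) ℝ}
    (hA : ∀ i j, MemLp (fun ω => A ω i j) 2 μ) : Integrable (fun ω => frobSq (A ω)) μ :=
  integrable_finsetSum _ fun i _ => integrable_finsetSum _ fun j _ => (hA i j).integrable_sq

theorem integral_frobSq {a b : ℕ} {A : Ω → Matrix (Fin a) (Fin b) ℝ}
    (hA : ∀ i j, MemLp (fun ω => A ω i j) 2 μ) :
    ∫ ω, frobSq (A ω) ∂μ = ∑ i, ∑ j, ∫ ω, A ω i j ^ 2 ∂μ := by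
  simp only [frobSq]
  rw [integral_finsetSum _ fun i _ => integrable_finsetSum _ fun j _ => (hA i j).integrable_sq]
  exact Finset.sum_congr rfl fun i _ => integral_finsetSum _ fun j _ => (hA i j).integrable_sq

/-- Markov's inequality. The strict inequality in the event keeps it valid for `x = 0`, where `f`
vanishes almost everywhere. -/
theorem measure_mul_lt_le [IsProbabilityMeasure μ] {f : Ω → ℝ} (h0 : ∀ ω, 0 ≤ f ω)
    (hf : Integrable f μ) {C x κ δ : ℝ} (hκ : 0 < κ) (hx : 0 ≤ x)
    (hC : C ≤ κ * δ) (hint : ∫ ω, f ω ∂μ ≤ C * x) :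
    μ {ω | κ * x < f ω} ≤ ENNReal.ofReal δ := by
  rcases hx.eq_or_lt with rfl | hx
  · have h1 : ∫ ω, f ω ∂μ = 0 :=
      le_antisymm (by simpa using hint) (integral_nonneg h0)
    have h2 := (integral_eq_zero_iff_of_nonneg h0 hf).1 h1
    have h3 : μ {ω | κ * 0 < f ω} = 0 := by
      rw [measure_eq_zero_iff_ae_notMem]
      filter_upwards [h2] with ω hω
      simp only [Pi.zero_apply] at hω
      simp [hω]
    rw [h3]
    exact zero_le
  · have h1 := mul_meas_ge_le_integral_of_nonneg (ae_of_all _ h0) hf (κ * x)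
    have h2 : κ * x * μ.real {ω | κ * x ≤ f ω} ≤ κ * x * δ :=
      h1.trans (hint.trans (by nlinarith [mul_le_mul_of_nonneg_right hC hx.le]))
    have h3 := le_of_mul_le_mul_left h2 (by positivity)
    refine (measure_mono fun ω (hω : κ * x < f ω) => ?_ :
      _ ≤ μ {ω | κ * x ≤ f ω}).trans ?_
    · exact hω.le
    · rw [← ofReal_measureReal]
      exact ENNReal.ofReal_le_ofReal h3

/-- Independent standardized variables with bounded fourth moments. -/
structure IsWhiteNoise (μ : Measure Ω) (ε : S → Ω → ℝ) (M : ℝ) : Prop where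
  measurable : ∀ q, Measurable (ε q)
  indep : iIndepFun ε μ
  memLp : ∀ q, MemLp (ε q) 4 μ
  mean : ∀ q, ∫ ω, ε q ω ∂μ = 0
  second : ∀ q, ∫ ω, ε q ω ^ 2 ∂μ = 1
  fourth : ∀ q, ∫ ω, ε q ω ^ 4 ∂μ ≤ M

namespace IsWhiteNoise

variable {ε : S → Ω → ℝ} {M : ℝ}

theorem memLp_two [IsProbabilityMeasure μ] (h : IsWhiteNoise μ ε M) (q : S) : MemLp (ε q) 2 μ :=
  (h.memLp q).mono_exponent (by norm_num)

theorem memLp_mul (h : IsWhiteNoise μ ε M) (q q' : S) :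
    MemLp (fun ω => ε q ω * ε q' ω) 2 μ := by
  have : ENNReal.HolderTriple 4 4 2 := ⟨by
    rw [← two_mul, show (4 : ENNReal) = 2 * 2 by norm_num,
      ENNReal.mul_inv (by simp) (by simp), ← mul_assoc, ENNReal.mul_inv_cancel (by simp) (by simp),
      one_mul]⟩
  exact (h.memLp q').mul (h.memLp q)

theorem indepFun_finset [DecidableEq S] (h : IsWhiteNoise μ ε M) {x : S} {s : Finset S}
    (hx : x ∉ s) : IndepFun (ε x) (fun ω (q : s) => ε q ω) μ := by
  have := h.indep.indepFun_finset {x} s (by simpa using hx) h.measurable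
  exact this.comp (φ := fun g : (({x} : Finset S) → ℝ) => g ⟨x, by simp⟩)
    (measurable_pi_apply _) measurable_id

/-- The indices `y`, `z`, `w` may coincide: a variable that occurs only once factors out by
independence and has mean zero. -/
theorem integral_mul_eq_zero [DecidableEq S] (h : IsWhiteNoise μ ε M) {x y z w : S}
    (hy : x ≠ y) (hz : x ≠ z) (hw : x ≠ w) :
    ∫ ω, (ε x ω * ε y ω) * (ε z ω * ε w ω) ∂μ = 0 := by
  have h1 := h.indepFun_finset (x := x) (s := {y, z, w}) (by simp [hy, hz, hw])
  have h2 := h1.comp (φ := id)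
    (ψ := fun g : ((({y, z, w} : Finset S)) → ℝ) =>
      g ⟨y, by simp⟩ * (g ⟨z, by simp⟩ * g ⟨w, by simp⟩)) measurable_id (by fun_prop)
  have hm := h.measurable
  have h3 := h2.integral_fun_mul_eq_mul_integral (hm x).aestronglyMeasurable
    (by simp only [Function.comp_def]; fun_prop)
  simp only [Function.comp_def, id_eq, h.mean, zero_mul] at h3
  simpa only [mul_assoc] using h3

theorem integral_pair_mul_eq_zero (h : IsWhiteNoise μ ε M) {x y : S} (hxy : x ≠ y) :
    ∫ ω, ε x ω * ε y ω ∂μ = 0 := by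
  have hm := h.measurable
  rw [(h.indep.indepFun hxy).integral_fun_mul_eq_mul_integral (hm x).aestronglyMeasurable
    (hm y).aestronglyMeasurable, h.mean, zero_mul]

theorem integral_comp_mul_comp (h : IsWhiteNoise μ ε M) {x y : S} (hxy : x ≠ y) {f g : ℝ → ℝ}
    (hf : Measurable f) (hg : Measurable g) :
    ∫ ω, f (ε x ω) * g (ε y ω) ∂μ = (∫ ω, f (ε x ω) ∂μ) * ∫ ω, g (ε y ω) ∂μ :=
  ((h.indep.indepFun hxy).comp hf hg).integral_fun_mul_eq_mul_integral
    (hf.comp (h.measurable x)).aestronglyMeasurable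
    (hg.comp (h.measurable y)).aestronglyMeasurable

theorem integral_mul_sq (h : IsWhiteNoise μ ε M) {x y : S} (hxy : x ≠ y) :
    ∫ ω, (ε x ω * ε y ω) ^ 2 ∂μ = 1 := by
  simp only [mul_pow]
  rw [h.integral_comp_mul_comp hxy (f := fun u => u ^ 2) (g := fun u => u ^ 2) (by fun_prop)
    (by fun_prop), h.second, h.second, one_mul]

theorem memLp_sq_sub_one [IsProbabilityMeasure μ] (h : IsWhiteNoise μ ε M) (x : S) :
    MemLp (fun ω => ε x ω ^ 2 - 1) 2 μ := by
  simp only [sq]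
  exact (h.memLp_mul x x).sub (memLp_const 1)

theorem integral_sq_sub_one [IsProbabilityMeasure μ] (h : IsWhiteNoise μ ε M) (x : S) :
    ∫ ω, (ε x ω ^ 2 - 1) ∂μ = 0 := by
  rw [integral_sub (h.memLp_two x).integrable_sq (integrable_const _), h.second]
  simp

theorem integral_sq_sub_one_sq_le [IsProbabilityMeasure μ] (h : IsWhiteNoise μ ε M) (x : S) :
    ∫ ω, (ε x ω ^ 2 - 1) ^ 2 ∂μ ≤ M := by
  have h4 : Integrable (fun ω => ε x ω ^ 4) μ := by
    have := (h.memLp_mul x x).integrable_sq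
    refine this.congr (ae_of_all _ fun ω => ?_)
    simp only
    ring
  have h2 := (h.memLp_two x).integrable_sq
  have e : ∀ ω, (ε x ω ^ 2 - 1) ^ 2 = ε x ω ^ 4 - 2 * ε x ω ^ 2 + 1 := fun ω => by ring
  simp_rw [e]
  have h42 : Integrable (fun ω => ε x ω ^ 4 - 2 * ε x ω ^ 2) μ := h4.sub (h2.const_mul 2)
  rw [integral_add h42 (integrable_const _), integral_sub h4 (h2.const_mul 2),
    integral_const_mul, h.second]
  have := h.fourth x
  simp
  linarith

variable {T p : ℕ} {e : Fin T × Fin p → Ω → ℝ}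

/-- The noise variables arranged as a matrix. -/
def noiseMatrix (e : Fin T × Fin p → Ω → ℝ) (ω : Ω) : Matrix (Fin T) (Fin p) ℝ :=
  Matrix.of fun t j => e (t, j) ω

theorem frobSq_noise_mul [IsProbabilityMeasure μ] {a : ℕ} (h : IsWhiteNoise μ e M) (G : Matrix (Fin p) (Fin a) ℝ) :
    Integrable (fun ω => frobSq (noiseMatrix e ω * G)) μ ∧
      ∫ ω, frobSq (noiseMatrix e ω * G) ∂μ = T * frobSq G := by
  have e1 : ∀ t k ω, (noiseMatrix e ω * G) t k = ∑ j, G j k * e (t, j) ω := fun t k ω => by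
    simp [Matrix.mul_apply, noiseMatrix, mul_comm]
  have h1 : ∀ t k, MemLp (fun ω => (noiseMatrix e ω * G) t k) 2 μ := fun t k => by
    simp_rw [e1]
    exact memLp_sum_mul (fun j _ => h.memLp_two (t, j)) _
  refine ⟨integrable_frobSq h1, ?_⟩
  rw [integral_frobSq h1]
  have h2 : ∀ t k, ∫ ω, (noiseMatrix e ω * G) t k ^ 2 ∂μ = ∑ j, G j k ^ 2 := fun t k => by
    simp_rw [e1]
    rw [integral_sum_sq_of_orthogonal (fun j _ => h.memLp_two (t, j))
      (fun j _ j' _ hj => h.integral_pair_mul_eq_zero (by simpa using hj))]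
    simp [h.second]
  simp_rw [h2]
  rw [Finset.sum_const, Finset.card_univ, Fintype.card_fin, nsmul_eq_mul, ← frobSq_transpose]
  rfl

/-- The entries of `W` may depend on each other: independence of `W` from the noise factors the
mixed moments, so the products `e q * W` inherit orthogonality from the noise alone. -/
theorem frobSq_mul_noise_transpose_mul [IsProbabilityMeasure μ] {a b : ℕ} (h : IsWhiteNoise μ e M)
    (G : Matrix (Fin a) (Fin p) ℝ) {W : Ω → Matrix (Fin T) (Fin b) ℝ}
    (hWm : ∀ t k, Measurable fun ω => W ω t k) (hW : ∀ t k, MemLp (fun ω => W ω t k) 2 μ)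
    (hind : IndepFun (fun ω q => e q ω) (fun ω (q : Fin T × Fin b) => W ω q.1 q.2) μ) :
    Integrable (fun ω => frobSq (G * (noiseMatrix e ω)ᵀ * W ω)) μ ∧
      ∫ ω, frobSq (G * (noiseMatrix e ω)ᵀ * W ω) ∂μ = frobSq G * ∫ ω, frobSq (W ω) ∂μ := by
  have e1 : ∀ i k ω, (G * (noiseMatrix e ω)ᵀ * W ω) i k
      = ∑ q : Fin T × Fin p, G i q.2 * (e q ω * W ω q.1 k) := fun i k ω => by
    simp only [Matrix.mul_apply, noiseMatrix, Matrix.transpose_apply, Matrix.of_apply,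
      Finset.sum_mul, Fintype.sum_prod_type, mul_assoc]
  have hm := h.measurable
  have hprod : ∀ (f : (Fin T × Fin p → ℝ) → ℝ) (g : (Fin T × Fin b → ℝ) → ℝ), Measurable f →
      Measurable g → IndepFun (fun ω => f fun q => e q ω)
        (fun ω => g fun q => W ω q.1 q.2) μ :=
    fun f g hf hg => hind.comp hf hg
  have hY : ∀ (q : Fin T × Fin p) (k : Fin b), MemLp (fun ω => e q ω * W ω q.1 k) 2 μ := by
    intro q k
    have hmeas : Measurable fun ω => e q ω * W ω q.1 k := (hm q).mul (hWm _ _)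
    refine (memLp_two_iff_integrable_sq hmeas.aestronglyMeasurable).2 ?_
    have := (hprod (fun u => u q ^ 2) (fun v => v (q.1, k) ^ 2) (by fun_prop)
      (by fun_prop)).integrable_mul (h.memLp_two q).integrable_sq (hW q.1 k).integrable_sq
    refine this.congr (ae_of_all _ fun ω => ?_)
    simp only [Pi.mul_apply, mul_pow]
  have hY2 : ∀ (q : Fin T × Fin p) (k : Fin b),
      ∫ ω, (e q ω * W ω q.1 k) ^ 2 ∂μ = ∫ ω, W ω q.1 k ^ 2 ∂μ := by
    intro q k
    simp only [mul_pow]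
    rw [(hprod (fun u => u q ^ 2) (fun v => v (q.1, k) ^ 2) (by fun_prop)
      (by fun_prop)).integral_fun_mul_eq_mul_integral (by fun_prop) (by fun_prop), h.second,
      one_mul]
  have horth : ∀ (q q' : Fin T × Fin p) (k : Fin b), q ≠ q' →
      ∫ ω, (e q ω * W ω q.1 k) * (e q' ω * W ω q'.1 k) ∂μ = 0 := by
    intro q q' k hq
    have := (hprod (fun u => u q * u q') (fun v => v (q.1, k) * v (q'.1, k)) (by fun_prop)
      (by fun_prop)).integral_fun_mul_eq_mul_integral (by fun_prop) (by fun_prop)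
    rw [h.integral_pair_mul_eq_zero hq, zero_mul] at this
    rw [← this]
    exact integral_congr_ae (ae_of_all _ fun ω => by simp only; ring)
  have h1 : ∀ i k, MemLp (fun ω => (G * (noiseMatrix e ω)ᵀ * W ω) i k) 2 μ := fun i k => by
    simp_rw [e1]
    exact memLp_sum_mul (fun q _ => hY q k) fun q => G i q.2
  refine ⟨integrable_frobSq h1, ?_⟩
  rw [integral_frobSq h1, integral_frobSq hW]
  have h2 : ∀ i k, ∫ ω, (G * (noiseMatrix e ω)ᵀ * W ω) i k ^ 2 ∂μ
      = (∑ j, G i j ^ 2) * ∑ t, ∫ ω, W ω t k ^ 2 ∂μ := fun i k => by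
    simp_rw [e1]
    rw [integral_sum_sq_of_orthogonal (fun q _ => hY q k) (fun q _ q' _ hq => horth q q' k hq)
      fun q => G i q.2]
    simp_rw [hY2]
    rw [Fintype.sum_prod_type, Finset.sum_mul_sum, Finset.sum_comm]
  simp_rw [h2]
  rw [frobSq, Finset.sum_mul]
  refine Finset.sum_congr rfl fun i _ => ?_
  rw [← Finset.mul_sum, Finset.sum_comm]

/-- Some index occurs exactly once: the smaller of `j`, `j'` if they differ, and otherwise `k`. -/
theorem integral_ordered_pairs (h : IsWhiteNoise μ e M) (t : Fin T) {j k j' k' : Fin p}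
    (hjk : j < k) (hjk' : j' < k') (hne : (j, k) ≠ (j', k')) :
    ∫ ω, (e (t, j) ω * e (t, k) ω) * (e (t, j') ω * e (t, k') ω) ∂μ = 0 := by
  have ne : ∀ {x y : Fin p}, x ≠ y → (t, x) ≠ (t, y) := fun hxy => by simpa using hxy
  rcases lt_trichotomy j j' with hj | rfl | hj
  · exact h.integral_mul_eq_zero (ne hjk.ne) (ne hj.ne) (ne (hj.trans hjk').ne)
  · have hk : k ≠ k' := fun hk => hne (by rw [hk])
    simp only [mul_comm (e (t, j) _) (e (t, k) _)]
    exact h.integral_mul_eq_zero (ne hjk.ne') (ne hjk.ne') (ne hk)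
  · simp only [mul_comm (e (t, j) _ * e (t, k) _) _]
    exact h.integral_mul_eq_zero (ne hjk'.ne) (ne hj.ne) (ne (hj.trans hjk).ne)

theorem quadratic_off_diagonal (h : IsWhiteNoise μ e M) (Q : Matrix (Fin p) (Fin p) ℝ)
    {s t : Fin T} (hst : s ≠ t) :
    MemLp (fun ω => ∑ q : Fin p × Fin p, Q q.1 q.2 * (e (s, q.1) ω * e (t, q.2) ω)) 2 μ ∧
      ∫ ω, (∑ q : Fin p × Fin p, Q q.1 q.2 * (e (s, q.1) ω * e (t, q.2) ω)) ^ 2 ∂μ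
        ≤ frobSq Q := by
  have hY : ∀ q : Fin p × Fin p, MemLp (fun ω => e (s, q.1) ω * e (t, q.2) ω) 2 μ :=
    fun q => h.memLp_mul _ _
  refine ⟨memLp_sum_mul (fun q _ => hY q) fun q => Q q.1 q.2, ?_⟩
  refine (integral_sum_sq_le_of_orthogonal (M := 1) (fun q _ => hY q) ?_ ?_
    fun q => Q q.1 q.2).trans (le_of_eq ?_)
  · rintro ⟨j, k⟩ - ⟨j', k'⟩ - hne
    by_cases hj : j = j'
    · have hk : k ≠ k' := fun hk => hne (by rw [hj, hk])
      simp only [mul_comm (e (s, j) _) (e (t, k) _)]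
      exact h.integral_mul_eq_zero (by simp [hst.symm]) (by simp [hst.symm]) (by simp [hk])
    · exact h.integral_mul_eq_zero (by simp [hst]) (by simp [hj]) (by simp [hst])
  · exact fun q _ => (h.integral_mul_sq (by simp [hst])).le
  · rw [one_mul, Fintype.sum_prod_type]
    rfl

/-- Within one row the monomials for `(j, k)` and `(k, j)` coincide, hence are not orthogonal. The
sum is split into its diagonal, upper and lower parts, each of which is orthogonal; they contribute
`M`, `1` and `1`, and the factor `3` comes from squaring a sum of three terms. -/
theorem quadratic_diagonal [IsProbabilityMeasure μ] (h : IsWhiteNoise μ e M) (hM : 0 ≤ M)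
    (Q : Matrix (Fin p) (Fin p) ℝ) (t : Fin T) :
    MemLp (fun ω => (∑ q : Fin p × Fin p, Q q.1 q.2 * (e (t, q.1) ω * e (t, q.2) ω)) - Q.trace)
      2 μ ∧
      ∫ ω, ((∑ q : Fin p × Fin p, Q q.1 q.2 * (e (t, q.1) ω * e (t, q.2) ω)) - Q.trace) ^ 2 ∂μ
        ≤ 3 * (M + 2) * frobSq Q := by
  let Y : Fin p × Fin p → Ω → ℝ := fun q ω => e (t, q.1) ω * e (t, q.2) ω
  let a : Fin p × Fin p → ℝ := fun q => Q q.1 q.2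
  let X₀ : Ω → ℝ := fun ω => ∑ j, Q j j * (e (t, j) ω ^ 2 - 1)
  let X₁ : Ω → ℝ := fun ω => ∑ q : Fin p × Fin p with q.1 < q.2, a q * Y q ω
  let X₂ : Ω → ℝ := fun ω => ∑ q : Fin p × Fin p with q.2 < q.1, a q * Y q ω
  have hY : ∀ q, MemLp (Y q) 2 μ := fun q => h.memLp_mul _ _
  have hX₀ : MemLp X₀ 2 μ := memLp_sum_mul (fun j _ => h.memLp_sq_sub_one (t, j)) fun j => Q j j
  have hX₁ : MemLp X₁ 2 μ := memLp_sum_mul (fun q _ => hY q) a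
  have hX₂ : MemLp X₂ 2 μ := memLp_sum_mul (fun q _ => hY q) a
  have hQ : ∀ s : Finset (Fin p × Fin p), ∑ q ∈ s, a q ^ 2 ≤ frobSq Q := fun s => by
    rw [frobSq, ← Fintype.sum_prod_type' (f := fun i j => Q i j ^ 2)]
    exact Finset.sum_le_univ_sum_of_nonneg fun q => sq_nonneg _
  have hI₀ : ∫ ω, X₀ ω ^ 2 ∂μ ≤ M * frobSq Q := by
    refine (integral_sum_sq_le_of_orthogonal (fun j _ => h.memLp_sq_sub_one (t, j)) ?_
      (fun j _ => h.integral_sq_sub_one_sq_le (t, j)) fun j => Q j j).trans ?_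
    · intro j _ k _ hjk
      rw [h.integral_comp_mul_comp (f := fun u => u ^ 2 - 1) (g := fun u => u ^ 2 - 1)
        (by simpa using hjk) (by fun_prop) (by fun_prop), h.integral_sq_sub_one, zero_mul]
    · refine mul_le_mul_of_nonneg_left (Finset.sum_le_sum fun i _ => ?_) hM
      exact Finset.single_le_sum (f := fun j => Q i j ^ 2) (fun _ _ => sq_nonneg _)
        (Finset.mem_univ i)
  have hI₁ : ∫ ω, X₁ ω ^ 2 ∂μ ≤ 1 * frobSq Q := by
    refine (integral_sum_sq_le_of_orthogonal (fun q _ => hY q) ?_ ?_ a).trans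
      (mul_le_mul_of_nonneg_left (hQ _) zero_le_one)
    · intro q hq q' hq' hne
      exact h.integral_ordered_pairs t (by simpa using hq) (by simpa using hq') hne
    · intro q hq
      have : q.1 < q.2 := by simpa using hq
      exact (h.integral_mul_sq (by simpa using this.ne)).le
  have hI₂ : ∫ ω, X₂ ω ^ 2 ∂μ ≤ 1 * frobSq Q := by
    refine (integral_sum_sq_le_of_orthogonal (fun q _ => hY q) ?_ ?_ a).trans
      (mul_le_mul_of_nonneg_left (hQ _) zero_le_one)
    · intro q hq q' hq' hne
      have := h.integral_ordered_pairs t (j := q.2) (k := q.1) (j' := q'.2) (k' := q'.1)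
        (by simpa using hq) (by simpa using hq') fun hc => hne (by
          rw [Prod.mk.injEq] at hc
          exact Prod.ext hc.2 hc.1)
      rw [← this]
      exact integral_congr_ae (ae_of_all _ fun ω => by simp only [Y]; ring)
    · intro q hq
      have : q.2 < q.1 := by simpa using hq
      exact (h.integral_mul_sq (by simpa using this.ne')).le
  have hsum : ∀ ω, (∑ q : Fin p × Fin p, Q q.1 q.2 * (e (t, q.1) ω * e (t, q.2) ω)) - Q.trace
      = X₀ ω + X₁ ω + X₂ ω := by
    intro ω
    have e1 : ∀ f : Fin p × Fin p → ℝ, ∑ q, f q = ∑ j, f (j, j)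
        + ∑ q : Fin p × Fin p with q.1 < q.2, f q + ∑ q : Fin p × Fin p with q.2 < q.1, f q := by
      intro f
      simp only [Finset.sum_filter, Fintype.sum_prod_type, ← Finset.sum_add_distrib]
      refine Finset.sum_congr rfl fun j _ => ?_
      have : f (j, j) = ∑ k, if j = k then f (j, k) else 0 := by simp
      rw [this]
      simp only [← Finset.sum_add_distrib]
      refine Finset.sum_congr rfl fun k _ => ?_
      rcases lt_trichotomy j k with hjk | rfl | hjk
      · simp [hjk, hjk.ne, hjk.not_gt]
      · simp
      · simp [hjk, hjk.ne', hjk.not_gt]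
    rw [e1]
    simp only [X₀, X₁, X₂, Y, a, Matrix.trace, Matrix.diag, mul_sub, mul_one,
      Finset.sum_sub_distrib, sq]
    ring
  simp_rw [hsum]
  refine ⟨(hX₀.add hX₁).add hX₂, ?_⟩
  have hint : Integrable (fun ω => 3 * (X₀ ω ^ 2 + X₁ ω ^ 2 + X₂ ω ^ 2)) μ :=
    ((hX₀.integrable_sq.add hX₁.integrable_sq).add hX₂.integrable_sq).const_mul 3
  calc ∫ ω, (X₀ ω + X₁ ω + X₂ ω) ^ 2 ∂μ
      ≤ ∫ ω, 3 * (X₀ ω ^ 2 + X₁ ω ^ 2 + X₂ ω ^ 2) ∂μ := by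
        refine integral_mono ((hX₀.add hX₁).add hX₂).integrable_sq hint fun ω => ?_
        nlinarith [sq_nonneg (X₀ ω - X₁ ω), sq_nonneg (X₀ ω - X₂ ω), sq_nonneg (X₁ ω - X₂ ω)]
    _ = 3 * (∫ ω, X₀ ω ^ 2 ∂μ + ∫ ω, X₁ ω ^ 2 ∂μ + ∫ ω, X₂ ω ^ 2 ∂μ) := by
        have h01 : Integrable (fun ω => X₀ ω ^ 2 + X₁ ω ^ 2) μ :=
          hX₀.integrable_sq.add hX₁.integrable_sq
        rw [integral_const_mul, integral_add h01 hX₂.integrable_sq, integral_add hX₀.integrable_sq hX₁.integrable_sq]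
    _ ≤ 3 * (M * frobSq Q + 1 * frobSq Q + 1 * frobSq Q) := by gcongr
    _ = _ := by ring

/-- The quadratic form of white noise concentrates around its mean in Frobenius norm. -/
theorem frobSq_quadratic [IsProbabilityMeasure μ] (h : IsWhiteNoise μ e M) (hM : 0 ≤ M)
    (Q : Matrix (Fin p) (Fin p) ℝ) :
    Integrable (fun ω => frobSq (noiseMatrix e ω * Q * (noiseMatrix e ω)ᵀ
      - Q.trace • (1 : Matrix (Fin T) (Fin T) ℝ))) μ ∧
      ∫ ω, frobSq (noiseMatrix e ω * Q * (noiseMatrix e ω)ᵀ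
        - Q.trace • (1 : Matrix (Fin T) (Fin T) ℝ)) ∂μ
        ≤ 3 * (M + 2) * ((T : ℝ) ^ 2 * frobSq Q) := by
  have e1 : ∀ s t ω, (noiseMatrix e ω * Q * (noiseMatrix e ω)ᵀ) s t
      = ∑ q : Fin p × Fin p, Q q.1 q.2 * (e (s, q.1) ω * e (t, q.2) ω) := fun s t ω => by
    simp only [Matrix.mul_apply, noiseMatrix, Matrix.transpose_apply, Matrix.of_apply,
      Finset.sum_mul, Fintype.sum_prod_type]
    rw [Finset.sum_comm]
    exact Finset.sum_congr rfl fun j _ => Finset.sum_congr rfl fun k _ => by ring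
  have h1 : ∀ s t, MemLp (fun ω => (noiseMatrix e ω * Q * (noiseMatrix e ω)ᵀ
      - Q.trace • (1 : Matrix (Fin T) (Fin T) ℝ)) s t) 2 μ ∧
      ∫ ω, (noiseMatrix e ω * Q * (noiseMatrix e ω)ᵀ
        - Q.trace • (1 : Matrix (Fin T) (Fin T) ℝ)) s t ^ 2 ∂μ ≤ 3 * (M + 2) * frobSq Q := by
    intro s t
    simp only [Matrix.sub_apply, Matrix.smul_apply, e1]
    by_cases hst : s = t
    · subst hst
      simpa using h.quadratic_diagonal hM Q s
    · simp only [Matrix.one_apply_ne hst, smul_zero, sub_zero]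
      refine ⟨(h.quadratic_off_diagonal Q hst).1, (h.quadratic_off_diagonal Q hst).2.trans ?_⟩
      have := frobSq_nonneg Q
      nlinarith [mul_nonneg hM this]
  refine ⟨integrable_frobSq fun s t => (h1 s t).1, ?_⟩
  rw [integral_frobSq fun s t => (h1 s t).1]
  calc _ ≤ ∑ _s : Fin T, ∑ _t : Fin T, 3 * (M + 2) * frobSq Q :=
        Finset.sum_le_sum fun s _ => Finset.sum_le_sum fun t _ => (h1 s t).2
    _ = _ := by
        simp only [Finset.sum_const, Finset.card_univ, Fintype.card_fin, nsmul_eq_mul]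
        ring

end IsWhiteNoise
end Moments
/-! ### Regular samples have high probability -/

section Probability

variable {Ω : Type*} [MeasurableSpace Ω] {μ : Measure Ω}

theorem IsSpectralDecomposition.le_dotProduct {r : ℕ} {G W : Matrix (Fin r) (Fin r) ℝ}
    {lam : Fin r → ℝ} (hG : IsSpectralDecomposition G W lam) {c : ℝ} (hc : ∀ k, c ≤ lam k)
    (y : Fin r → ℝ) : c * (y ⬝ᵥ y) ≤ y ⬝ᵥ (G *ᵥ y) := by
  have hWW : W * Wᵀ = 1 := mul_eq_one_comm.1 hG.orthogonal
  have h1 : y ⬝ᵥ y = (Wᵀ *ᵥ y) ⬝ᵥ (Wᵀ *ᵥ y) := by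
    rw [Matrix.dotProduct_mulVec (Wᵀ *ᵥ _), Matrix.vecMul_transpose, Matrix.mulVec_mulVec,
      hWW, Matrix.one_mulVec]
  rw [h1, hG.eq_mul, ← Matrix.mulVec_mulVec, ← Matrix.mulVec_mulVec, Matrix.dotProduct_mulVec y,
    ← Matrix.mulVec_transpose, dotProduct, dotProduct, Finset.mul_sum]
  refine Finset.sum_le_sum fun i _ => ?_
  rw [Matrix.mulVec_diagonal]
  nlinarith [mul_le_mul_of_nonneg_right (hc i) (mul_self_nonneg ((Wᵀ *ᵥ y) i))]

theorem frobSq_le_of_abs_le {a b : ℕ} {A : Matrix (Fin a) (Fin b) ℝ} {M : ℝ}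
    (h : ∀ i j, |A i j| ≤ M) : frobSq A ≤ M ^ 2 * b * a := by
  calc frobSq A ≤ ∑ _i : Fin a, ∑ _j : Fin b, M ^ 2 :=
        Finset.sum_le_sum fun i _ => Finset.sum_le_sum fun j _ => sq_le_sq' (abs_le.1 (h i j)).1
          (abs_le.1 (h i j)).2
    _ = _ := by
        simp only [Finset.sum_const, Finset.card_univ, Fintype.card_fin, nsmul_eq_mul]
        ring

variable {T p r : ℕ} {F : Ω → Matrix (Fin T) (Fin r) ℝ} {B : Matrix (Fin p) (Fin r) ℝ}
  {E ε : Ω → Matrix (Fin T) (Fin p) ℝ} {P₁ : Matrix (Fin T) (Fin T) ℝ}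
  {P₂ : Matrix (Fin p) (Fin p) ℝ} {M M' b c₁ c₂ : ℝ}

theorem ErrorCondition.isWhiteNoise (h : ErrorCondition μ F E ε P₁ P₂ M c₁ c₂) :
    IsWhiteNoise μ (fun (q : Fin T × Fin p) ω => ε ω q.1 q.2) M where
  measurable q := h.measurable q.1 q.2
  indep := h.indep
  memLp q := h.memLp q.1 q.2
  mean q := h.mean q.1 q.2
  second q := h.second q.1 q.2
  fourth q := h.fourth q.1 q.2

variable [IsProbabilityMeasure μ]

theorem FactorCondition.integral_frobSq_mul_le (h : FactorCondition μ F M')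
    {P : Matrix (Fin T) (Fin T) ℝ} (hP : OpBound c₁ P) :
    (∀ t k, MemLp (fun ω => (P * F ω) t k) 2 μ) ∧
      ∫ ω, frobSq (P * F ω) ∂μ ≤ c₁ * (T * r) := by
  have hF : ∀ t k, MemLp (fun ω => F ω t k) 2 μ := fun t k =>
    (h.memLp t k).mono_exponent (by norm_num)
  have hPF : ∀ t k, MemLp (fun ω => (P * F ω) t k) 2 μ := fun t k => by
    simp only [Matrix.mul_apply]
    exact memLp_sum_mul (fun s _ => hF s k) fun s => P t s
  refine ⟨hPF, ?_⟩
  calc ∫ ω, frobSq (P * F ω) ∂μ ≤ ∫ ω, c₁ * frobSq (F ω) ∂μ :=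
        integral_mono (integrable_frobSq hPF) ((integrable_frobSq hF).const_mul _)
          fun ω => hP.frobSq_mul_le _
    _ = _ := by
        rw [integral_const_mul, integral_frobSq hF]
        simp [h.second]

/-- The constant of the regular samples which occur with probability at least `1 - δ`. -/
noncomputable def regularityConstant (r : ℕ) (M b c₁ δ : ℝ) : ℝ :=
  (4 * (3 * (M + 2) + r + 1) / δ + 1) * (c₁ ^ 2 * (b ^ 2 * r) + c₁ ^ 2 + 2 * c₁ ^ 4) + b ^ 2 * r

theorem regularityConstant_nonneg (r : ℕ) {M b c₁ δ : ℝ} (hM : 0 ≤ M) (hδ : 0 < δ) :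
    0 ≤ regularityConstant r M b c₁ δ := by
  unfold regularityConstant
  positivity

theorem measure_not_isRegularSample_le (hErr : ErrorCondition μ F E ε P₁ P₂ M c₁ c₂)
    (hF : FactorCondition μ F M') (hM : 0 ≤ M) (hc₁ : 0 ≤ c₁) {K : Matrix (Fin p) (Fin p) ℝ}
    (hK : IsShrinkage K) (hB : ∀ j k, |B j k| ≤ b) {c : ℝ}
    (hS : ∀ y, c * (y ⬝ᵥ y) ≤ y ⬝ᵥ (((p : ℝ)⁻¹ • (Bᵀ * K * B)) *ᵥ y))
    {Fhat : Ω → Matrix (Fin T) (Fin r) ℝ}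
    (hFhat : ∀ᵐ ω ∂μ, ∃ V : Matrix (Fin T) (Fin r) ℝ, IsLeadingEigenvectors
      (((p : ℝ) * T)⁻¹ • (data (F ω) B (E ω) * K * (data (F ω) B (E ω))ᵀ)) V ∧
      Fhat ω = √(T : ℝ) • V) {δ : ℝ} (hδ : 0 < δ) :
    μ {ω | ¬ IsRegularSample (regularityConstant r M b c₁ δ) c (F ω) B (E ω) K (Fhat ω)}
      ≤ ENNReal.ofReal δ := by
  have hw := hErr.isWhiteNoise
  have hεm : ∀ ω, IsWhiteNoise.noiseMatrix (fun (q : Fin T × Fin p) ω => ε ω q.1 q.2) ω = ε ω :=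
    fun ω => rfl
  have hP₁ : OpBound c₁ P₁ := opBound_of_spectrum fun x hx => (hErr.spectrum_left hx).2
  have hP₂ : OpBound c₁ P₂ := opBound_of_spectrum fun x hx => (hErr.spectrum_right hx).2
  have hP₁t := hP₁.transpose hc₁
  have hP₂t := hP₂.transpose hc₁
  -- Each of the four events gets probability `δ / 4`; the numerator dominates all their moment
  -- constants `1`, `1`, `r` and `3 (M + 2)`.
  set κ : ℝ := 4 * (3 * (M + 2) + r + 1) / δ with hκdef
  have hκ : 0 < κ := by positivity
  have hκδ : 3 * (M + 2) + r + 1 = κ * (δ / 4) := by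
    rw [hκdef]; field_simp
  have hr0 : (0 : ℝ) ≤ r := Nat.cast_nonneg r
  have hC1 : (1 : ℝ) ≤ κ * (δ / 4) := by rw [← hκδ]; linarith
  have hC2 : (r : ℝ) ≤ κ * (δ / 4) := by rw [← hκδ]; linarith
  have hC3 : 3 * (M + 2) ≤ κ * (δ / 4) := by rw [← hκδ]; linarith
  set Q := P₂ * K * P₂ᵀ with hQ
  have hK0 := frobSq_nonneg K
  have hQK : frobSq Q ≤ c₁ ^ 2 * frobSq K := by
    calc frobSq Q ≤ c₁ * (c₁ * frobSq K) :=
          (hP₂t.frobSq_mul_le_right hc₁ _).trans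
            (mul_le_mul_of_nonneg_left (hP₂.frobSq_mul_le _) hc₁)
      _ = _ := by ring
  -- Cauchy–Schwarz for `tr(P₂ᵀ P₂ K)` gives `p ‖K‖_F²`, which retains the gain from shrinkage.
  have hQtr : Q.trace ^ 2 ≤ c₁ ^ 2 * p * frobSq K := by
    rw [hQ, Matrix.trace_mul_comm, ← Matrix.mul_assoc]
    refine (trace_mul_sq_le _ _).trans (mul_le_mul_of_nonneg_right ?_ hK0)
    refine (hP₂t.frobSq_mul_le _).trans ?_
    have := hP₂.frobSq_mul_le (1 : Matrix (Fin p) (Fin p) ℝ)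
    rw [Matrix.mul_one, frobSq_one] at this
    nlinarith
  -- the exceptional events
  obtain ⟨i1, m1⟩ := hw.frobSq_noise_mul (P₂ * K * B)
  obtain ⟨i2, m2⟩ := hw.frobSq_noise_mul (P₂ * K)
  obtain ⟨hW, hWint⟩ := hF.integral_frobSq_mul_le hP₁t
  have hWm : ∀ t k, Measurable fun ω => (P₁ᵀ * F ω) t k := fun t k => by
    simp only [Matrix.mul_apply]
    exact Finset.measurable_sum _ fun s _ => (hF.measurable s k).const_mul _
  have hind : IndepFun (fun ω (q : Fin T × Fin p) => ε ω q.1 q.2)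
      (fun ω (q : Fin T × Fin r) => (P₁ᵀ * F ω) q.1 q.2) μ :=
    hErr.indep_factor.comp (φ := id)
      (ψ := fun (g : Fin T × Fin r → ℝ) (q : Fin T × Fin r) => ∑ s, P₁ᵀ q.1 s * g (s, q.2)) measurable_id
      (by fun_prop)
  obtain ⟨i3, m3⟩ := hw.frobSq_mul_noise_transpose_mul (K * P₂ᵀ) hWm hW hind
  obtain ⟨i4, m4⟩ := hw.frobSq_quadratic hM Q
  simp only [hεm] at i1 i2 i3 i4 m1 m2 m3 m4
  have b1 : frobSq (P₂ * K * B) ≤ c₁ * (b ^ 2 * r * p) := by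
    rw [Matrix.mul_assoc]
    refine (hP₂.frobSq_mul_le _).trans (mul_le_mul_of_nonneg_left ?_ hc₁)
    have := hK.contraction.frobSq_mul_le B
    rw [one_mul] at this
    exact this.trans (frobSq_le_of_abs_le hB)
  have b2 : frobSq (P₂ * K) ≤ c₁ * frobSq K := hP₂.frobSq_mul_le _
  have b3 : frobSq (K * P₂ᵀ) ≤ c₁ * frobSq K := hP₂t.frobSq_mul_le_right hc₁ _
  have p1 := measure_mul_lt_le (fun ω => frobSq_nonneg (ε ω * (P₂ * K * B))) i1
    (x := T * (c₁ * (b ^ 2 * r * p))) hκ (by positivity) hC1 (by rw [m1, one_mul]; gcongr)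
  have p2 := measure_mul_lt_le (fun ω => frobSq_nonneg (ε ω * (P₂ * K))) i2
    (x := T * (c₁ * frobSq K)) hκ (by positivity) hC1 (by rw [m2, one_mul]; gcongr)
  have p3 := measure_mul_lt_le (fun ω => frobSq_nonneg (K * P₂ᵀ * (ε ω)ᵀ * (P₁ᵀ * F ω))) i3
    (x := c₁ * frobSq K * (c₁ * T)) hκ (by positivity) hC2 (by
      rw [m3]
      refine (mul_le_mul b3 hWint (integral_nonneg fun ω => frobSq_nonneg _)
        (by positivity)).trans (le_of_eq ?_)
      ring)
  have p4 := measure_mul_lt_le (fun ω => frobSq_nonneg (ε ω * Q * (ε ω)ᵀ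
      - Q.trace • (1 : Matrix (Fin T) (Fin T) ℝ))) i4
    (x := (T : ℝ) ^ 2 * frobSq Q) hκ (mul_nonneg (by positivity) (frobSq_nonneg _)) hC3 m4
  set s1 := {ω | κ * (T * (c₁ * (b ^ 2 * r * p))) < frobSq (ε ω * (P₂ * K * B))}
  set s2 := {ω | κ * (T * (c₁ * frobSq K)) < frobSq (ε ω * (P₂ * K))}
  set s3 := {ω | κ * (c₁ * frobSq K * (c₁ * T)) < frobSq (K * P₂ᵀ * (ε ω)ᵀ * (P₁ᵀ * F ω))}
  set s4 := {ω | κ * ((T : ℝ) ^ 2 * frobSq Q) < frobSq (ε ω * Q * (ε ω)ᵀ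
      - Q.trace • (1 : Matrix (Fin T) (Fin T) ℝ))}
  have hunion : μ (s1 ∪ s2 ∪ s3 ∪ s4) ≤ ENNReal.ofReal δ := by
    calc μ (s1 ∪ s2 ∪ s3 ∪ s4) ≤ μ s1 + μ s2 + μ s3 + μ s4 :=
          (measure_union_le _ _).trans (add_le_add_left ((measure_union_le _ _).trans
            (add_le_add_left (measure_union_le _ _) _)) _)
      _ ≤ ENNReal.ofReal (δ / 4) + ENNReal.ofReal (δ / 4) + ENNReal.ofReal (δ / 4)
          + ENNReal.ofReal (δ / 4) := by gcongr
      _ = ENNReal.ofReal δ := by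
          rw [← ENNReal.ofReal_add (by positivity) (by positivity),
            ← ENNReal.ofReal_add (by positivity) (by positivity),
            ← ENNReal.ofReal_add (by positivity) (by positivity)]
          congr 1
          ring
  refine (measure_mono_ae ?_).trans hunion
  filter_upwards [hFhat, hF.normalized] with ω hω1 hω2 hreg
  by_contra hnot
  refine hreg ?_
  have hnot' : ω ∉ s1 ∪ s2 ∪ s3 ∪ s4 := hnot
  simp only [Set.mem_union, not_or, s1, s2, s3, s4, Set.mem_ofPred_eq, not_lt] at hnot'
  obtain ⟨⟨⟨n1, n2⟩, n3⟩, n4⟩ := hnot'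
  have hk : regularityConstant r M b c₁ δ
      = (κ + 1) * (c₁ ^ 2 * (b ^ 2 * r) + c₁ ^ 2 + 2 * c₁ ^ 4) + b ^ 2 * r := rfl
  have hbr : 0 ≤ b ^ 2 * r := by positivity
  have hk1 : κ * (c₁ ^ 2 * (b ^ 2 * r)) ≤ regularityConstant r M b c₁ δ := by
    rw [hk]
    have : 0 ≤ c₁ ^ 2 * (b ^ 2 * r) + (κ + 1) * (c₁ ^ 2 + 2 * c₁ ^ 4) := by positivity
    linarith
  have hk2 : κ * c₁ ^ 2 ≤ regularityConstant r M b c₁ δ := by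
    rw [hk]
    have : 0 ≤ c₁ ^ 2 + (κ + 1) * (c₁ ^ 2 * (b ^ 2 * r) + 2 * c₁ ^ 4) := by positivity
    linarith
  have hk3 : 2 * (κ + 1) * c₁ ^ 4 ≤ regularityConstant r M b c₁ δ := by
    rw [hk]
    have : 0 ≤ (κ + 1) * (c₁ ^ 2 * (b ^ 2 * r) + c₁ ^ 2) := by positivity
    linarith
  have hk4 : b ^ 2 * r ≤ regularityConstant r M b c₁ δ := by
    rw [hk]
    exact le_add_of_nonneg_left (by positivity)
  have hEω := hErr.eq_mul ω
  have hEK : frobSq (E ω * K) ≤ regularityConstant r M b c₁ δ * T * frobSq K := by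
    rw [hEω, Matrix.mul_assoc, Matrix.mul_assoc P₁]
    calc _ ≤ c₁ * (κ * (T * (c₁ * frobSq K))) :=
          (hP₁.frobSq_mul_le _).trans (mul_le_mul_of_nonneg_left n2 hc₁)
      _ = κ * c₁ ^ 2 * T * frobSq K := by ring
      _ ≤ _ := by gcongr
  refine ⟨hK, ?_, hS, hω2, hω1, ?_, ?_, ?_, fun G => ?_⟩
  · exact (frobSq_le_of_abs_le hB).trans (by gcongr)
  · have e : E ω * K * B = P₁ * (ε ω * (P₂ * K * B)) := by
      rw [hEω]; simp only [Matrix.mul_assoc]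
    rw [e]
    calc _ ≤ c₁ * (κ * (T * (c₁ * (b ^ 2 * r * p)))) :=
          (hP₁.frobSq_mul_le _).trans (mul_le_mul_of_nonneg_left n1 hc₁)
      _ = κ * (c₁ ^ 2 * (b ^ 2 * r)) * T * p := by ring
      _ ≤ _ := by gcongr
  · have e : K * (E ω)ᵀ * F ω = K * P₂ᵀ * (ε ω)ᵀ * (P₁ᵀ * F ω) := by
      rw [hEω]; simp only [Matrix.transpose_mul, Matrix.mul_assoc]
    rw [e]
    calc _ ≤ _ := n3
      _ = κ * c₁ ^ 2 * T * frobSq K := by ring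
      _ ≤ _ := by gcongr
  · rw [← frobSq_transpose, Matrix.transpose_mul, Matrix.transpose_transpose, hK.symm]
    exact hEK
  · set Z := ε ω * Q * (ε ω)ᵀ - Q.trace • (1 : Matrix (Fin T) (Fin T) ℝ) with hZ
    -- The fluctuation `Z` is bounded in Frobenius norm. The trace part acts on `G` as a multiple of
    -- `P₁ P₁ᵀ` and is bounded in operator norm, which avoids a factor `T`.
    have e : E ω * K * (E ω)ᵀ * G = P₁ * Z * P₁ᵀ * G + Q.trace • (P₁ * (P₁ᵀ * G)) := by
      have : E ω * K * (E ω)ᵀ = P₁ * (ε ω * Q * (ε ω)ᵀ) * P₁ᵀ := by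
        rw [hEω, hQ]; simp only [Matrix.transpose_mul, Matrix.mul_assoc]
      have e' : ε ω * Q * (ε ω)ᵀ = Z + Q.trace • (1 : Matrix (Fin T) (Fin T) ℝ) := by
        rw [hZ]; abel
      rw [this, e', Matrix.mul_add, Matrix.add_mul, Matrix.add_mul, Matrix.mul_smul,
        Matrix.mul_one, Matrix.smul_mul, Matrix.smul_mul, Matrix.mul_assoc P₁ P₁ᵀ G]
    have hG0 := frobSq_nonneg G
    have f1 : frobSq (P₁ * Z * P₁ᵀ * G) ≤ κ * c₁ ^ 4 * (T : ℝ) ^ 2 * frobSq K * frobSq G := by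
      refine (frobSq_mul_le _ _).trans (mul_le_mul_of_nonneg_right ?_ hG0)
      calc _ ≤ c₁ * (c₁ * frobSq Z) :=
            (hP₁t.frobSq_mul_le_right hc₁ _).trans
              (mul_le_mul_of_nonneg_left (hP₁.frobSq_mul_le _) hc₁)
        _ ≤ c₁ * (c₁ * (κ * ((T : ℝ) ^ 2 * (c₁ ^ 2 * frobSq K)))) := by
            gcongr
            exact n4.trans (by gcongr)
        _ = _ := by ring
    have f2 : frobSq (Q.trace • (P₁ * (P₁ᵀ * G))) ≤ c₁ ^ 4 * p * frobSq K * frobSq G := by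
      rw [frobSq_smul]
      calc _ ≤ (c₁ ^ 2 * p * frobSq K) * (c₁ * (c₁ * frobSq G)) :=
            mul_le_mul hQtr ((hP₁.frobSq_mul_le _).trans
              (mul_le_mul_of_nonneg_left (hP₁t.frobSq_mul_le _) hc₁)) (frobSq_nonneg _)
              (by positivity)
        _ = _ := by ring
    rw [e]
    calc _ ≤ _ := frobSq_add_le _ _
      _ ≤ 2 * (κ * c₁ ^ 4 * (T : ℝ) ^ 2 * frobSq K * frobSq G
            + c₁ ^ 4 * p * frobSq K * frobSq G) := by gcongr
      -- The missing cross terms are added so that the sum factors as `(κ + 1) (T² + p)`.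
      _ ≤ 2 * (κ * c₁ ^ 4 * (T : ℝ) ^ 2 * frobSq K * frobSq G
            + c₁ ^ 4 * p * frobSq K * frobSq G)
            + 2 * (c₁ ^ 4 * (T : ℝ) ^ 2 + κ * c₁ ^ 4 * p) * frobSq K * frobSq G :=
          le_add_of_nonneg_right (by positivity)
      _ = 2 * (κ + 1) * c₁ ^ 4 * ((T : ℝ) ^ 2 + p) * frobSq K * frobSq G := by ring
      _ ≤ _ := by gcongr

end Probability
-- Invertibility of the rotation, and passage to stochastic orders
section Asymptotics

/-- A null vector `v` of `H` would be sent to `-v` by `Hᵀ H - 1`, which is a strict contraction. -/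
theorem isUnit_of_frobSq_gram_lt {r : ℕ} {H : Matrix (Fin r) (Fin r) ℝ}
    (h : frobSq (Hᵀ * H - 1) < 1) : IsUnit H := by
  rw [Matrix.isUnit_iff_isUnit_det, isUnit_iff_ne_zero]
  intro hdet
  obtain ⟨v, hv0, hv⟩ := Matrix.exists_mulVec_eq_zero_iff.2 hdet
  have h1 := opBound_frobSq (Hᵀ * H - 1) v
  rw [Matrix.sub_mulVec, ← Matrix.mulVec_mulVec, hv, Matrix.mulVec_zero, Matrix.one_mulVec,
    zero_sub, neg_dotProduct_neg] at h1
  have h2 : 0 < v ⬝ᵥ v := lt_of_le_of_ne (dotProduct_self_nonneg' v) fun h =>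
    hv0 (dotProduct_self_eq_zero.1 h.symm)
  nlinarith

open Classical in
/-- The regression coefficients of the estimated scores on the factor scores, replaced by the
identity matrix where they are not invertible. -/
noncomputable def invertibleRotation {T r : ℕ} (F Fhat : Matrix (Fin T) (Fin r) ℝ) :
    Matrix (Fin r) (Fin r) ℝ :=
  if IsUnit (rotation F Fhat) then rotation F Fhat else 1

theorem isUnit_invertibleRotation {T r : ℕ} (F Fhat : Matrix (Fin T) (Fin r) ℝ) :
    IsUnit (invertibleRotation F Fhat) := by
  unfold invertibleRotation
  split_ifs with h
  · exact h
  · exact isUnit_one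

theorem measurable_invertibleRotation {Ω : Type*} [MeasurableSpace Ω] {T r : ℕ}
    {F Fhat : Ω → Matrix (Fin T) (Fin r) ℝ} (hF : ∀ t k, Measurable fun ω => F ω t k)
    (hFhat : ∀ t k, Measurable fun ω => Fhat ω t k) (i j : Fin r) :
    Measurable fun ω => invertibleRotation (F ω) (Fhat ω) i j := by
  have h1 : ∀ i j, Measurable fun ω => rotation (F ω) (Fhat ω) i j := fun i j => by
    simp only [rotation, Matrix.smul_apply, Matrix.mul_apply, Matrix.transpose_apply, smul_eq_mul]
    exact (Finset.measurable_sum _ fun s _ => (hF s i).mul (hFhat s j)).const_mul _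
  have h2 : Measurable fun ω => (rotation (F ω) (Fhat ω)).det := by
    simp only [Matrix.det_apply]
    exact Finset.measurable_sum _ fun σ _ =>
      (Finset.measurable_prod _ fun i _ => h1 _ _).const_smul _
  have h3 : MeasurableSet {ω | IsUnit (rotation (F ω) (Fhat ω))} := by
    simp only [Matrix.isUnit_iff_isUnit_det, isUnit_iff_ne_zero]
    exact (h2 (measurableSet_singleton 0)).compl
  have h4 : (fun ω => invertibleRotation (F ω) (Fhat ω) i j) = fun ω =>
      {ω | IsUnit (rotation (F ω) (Fhat ω))}.indicator
        (fun ω => rotation (F ω) (Fhat ω) i j - (1 : Matrix (Fin r) (Fin r) ℝ) i j) ω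
        + (1 : Matrix (Fin r) (Fin r) ℝ) i j := by
    ext ω
    by_cases h : IsUnit (rotation (F ω) (Fhat ω)) <;>
      simp [invertibleRotation, Set.indicator, h]
  rw [h4]
  exact (((h1 i j).sub_const _).indicator h3).add_const _

variable {Ω : Type*} [MeasurableSpace Ω] {μ : Measure Ω} {ι : Type*} {l : Filter ι}

/-- A deterministic bound on events of probability at least `1 - δ` suffices; `k`, and with it the
constant `C`, may grow as `δ` decreases. -/
theorem IsBigOp.of_regular {Y : ι → Ω → ℝ} {a : ι → ℝ} {R : ℝ → ι → Ω → Prop}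
    (hR : ∀ δ : ℝ, 0 < δ → ∃ k : ℝ, 0 ≤ k ∧
      ∀ᶠ n in l, μ {ω | ¬ R k n ω} ≤ ENNReal.ofReal δ)
    (hY : ∀ k : ℝ, 0 ≤ k → ∃ C : ℝ, 0 ≤ C ∧
      ∀ᶠ n in l, ∀ ω, R k n ω → 0 ≤ Y n ω ∧ 0 ≤ a n ∧ Y n ω ≤ C * a n) :
    IsBigOp μ l Y a := by
  intro δ hδ
  obtain ⟨k, hk, hRk⟩ := hR δ hδ
  obtain ⟨C, hC, hYC⟩ := hY k hk
  refine ⟨C + 1, by positivity, ?_⟩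
  filter_upwards [hRk, hYC] with n h1 h2
  refine (measure_mono fun ω hω hreg => ?_).trans h1
  obtain ⟨h3, h4, h5⟩ := h2 ω hreg
  have hω' : (C + 1) * |a n| < |Y n ω| := hω
  rw [abs_of_nonneg h3, abs_of_nonneg h4] at hω'
  linarith

end Asymptotics
end NFM

/-! ### Assembly of the convergence rates -/

theorem theorem4p1 {Ω : Type*} [MeasurableSpace Ω] (μ : Measure Ω) [IsProbabilityMeasure μ]
    {ι : Type*} (l : Filter ι) (r : ℕ) (p T : ι → ℕ)
    -- factor scores, loadings, errors
    (F : ∀ n, Ω → Matrix (Fin (T n)) (Fin r) ℝ)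
    (B : ∀ n, Matrix (Fin (p n)) (Fin r) ℝ)
    (E : ∀ n, Ω → Matrix (Fin (T n)) (Fin (p n)) ℝ)
    -- network, tuning parameters, penalty matrix
    (A : ∀ n, Matrix (Fin (p n)) (Fin (p n)) ℝ) (hAdj : ∀ n, NFM.IsAdjacency (A n))
    (α : ι → ℝ) (hα : ∀ n, 0 ≤ α n) (m : ι → ℕ)
    (D : ∀ n, Matrix (Fin (p n)) (Fin (p n)) ℝ)
    (hD : (∀ n, NFM.IsLaplacianPenalty (A n) (α n) (D n)) ∨
      (∀ n, NFM.IsProjectionPenalty (A n) (α n) (m n) (D n)))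
    (hA : NFM.AssumptionA l p T)
    (hB : NFM.AssumptionB μ l F)
    (hC : NFM.AssumptionC l B)
    (hErr : NFM.AssumptionD μ l F E)
    (hE : NFM.AssumptionE l B D)
    -- estimated factor scores
    (Fhat : ∀ n, Ω → Matrix (Fin (T n)) (Fin r) ℝ)
    (hFhat_meas : ∀ n t k, Measurable fun ω => Fhat n ω t k)
    (hFhat : ∀ᶠ n in l, ∀ᵐ ω ∂μ,
      NFM.IsScoreEstimator (NFM.data (F n ω) (B n) (E n ω)) (D n) (Fhat n ω)) :
    ∃ H : ι → Ω → Matrix (Fin r) (Fin r) ℝ,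
      (∀ n i j, Measurable fun ω => H n ω i j) ∧
      (∀ n ω, IsUnit (H n ω)) ∧
      (∀ i j, TendstoInMeasure μ (fun n ω => ((H n ω)ᵀ * H n ω) i j) l
        (fun _ => (1 : Matrix (Fin r) (Fin r) ℝ) i j)) ∧
      NFM.IsBigOp μ l
        (fun n ω => (T n : ℝ)⁻¹ * NFM.frobSq (Fhat n ω - F n ω * H n ω))
        (fun n => 1 / (p n : ℝ) + ((D n)⁻¹ ^ 2).trace / ((p n : ℝ) * (T n : ℝ) ^ 2)) ∧
      NFM.IsBigOp μ l
        (fun n ω => (p n : ℝ)⁻¹ * NFM.frobSq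
          (NFM.loadingEstimator (NFM.data (F n ω) (B n) (E n ω)) (D n) (Fhat n ω)
            - B n * H n ω))
        (fun n => (p n : ℝ)⁻¹ * NFM.frobSq (((D n)⁻¹ - 1) * B n)
          + ((D n)⁻¹ ^ 2).trace / ((p n : ℝ) * T n)) ∧
      NFM.IsBigOp μ l
        (fun n ω => ((p n : ℝ) * T n)⁻¹ * NFM.frobSq
          (NFM.common (Fhat n ω)
              (NFM.loadingEstimator (NFM.data (F n ω) (B n) (E n ω)) (D n) (Fhat n ω))
            - NFM.common (F n ω) (B n)))
        (fun n => (p n : ℝ)⁻¹ * NFM.frobSq (((D n)⁻¹ - 1) * B n)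
          + ((D n)⁻¹ ^ 2).trace / ((p n : ℝ) * T n) + 1 / (p n : ℝ)) := by
  open NFM in
  classical
  obtain ⟨hp, hT, C, hC0, hTp⟩ := hA
  obtain ⟨M', -, hF⟩ := hB
  obtain ⟨⟨b, -, hb⟩, -⟩ := hC
  obtain ⟨M, c₁, c₂, hM, hc₁, -, hErr⟩ := hErr
  obtain ⟨c, hc, hE⟩ := hE
  have hK : ∀ n, IsShrinkage (D n)⁻¹ := fun n =>
    isShrinkage_of_penalty (hAdj n) (hα n) (hD.imp (fun h => h n) fun h => h n)
  let R : ℝ → ι → Ω → Prop := fun k n ω =>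
    IsRegularSample k c (F n ω) (B n) (E n ω) (D n)⁻¹ (Fhat n ω)
  have hR : ∀ δ : ℝ, 0 < δ → ∃ k : ℝ, 0 ≤ k ∧
      ∀ᶠ n in l, μ {ω | ¬ R k n ω} ≤ ENNReal.ofReal δ := by
    intro δ hδ
    refine ⟨regularityConstant r M b c₁ δ, regularityConstant_nonneg r hM.le hδ, ?_⟩
    filter_upwards [hF, hb, hErr, hE, hFhat] with n h1 h2 h3 h4 h5
    obtain ⟨ε, P₁, P₂, h3⟩ := h3
    obtain ⟨W, lam, h4, -, h4c⟩ := h4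
    exact measure_not_isRegularSample_le h3 h1 hM.le hc₁.le (hK n) h2
      (h4.le_dotProduct h4c) h5 hδ
  -- Measurability of `F n` is known only eventually, whereas `H n` must be measurable for every
  -- `n`; hence the default value `1`.
  let H : ι → Ω → Matrix (Fin r) (Fin r) ℝ := fun n ω =>
    if ∀ t k, Measurable fun ω => F n ω t k then invertibleRotation (F n ω) (Fhat n ω) else 1
  -- the rate of the estimated scores on regular samples
  have hρ : ∀ k : ℝ, 0 ≤ k → ∃ C₁ : ℝ, 0 ≤ C₁ ∧ ∀ᶠ n in l, ∀ ω, R k n ω →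
      0 < T n ∧ (T n : ℝ)⁻¹ * frobSq (Fhat n ω - F n ω * rotation (F n ω) (Fhat n ω))
        ≤ C₁ * (1 / (p n : ℝ) + ((D n)⁻¹ ^ 2).trace / ((p n : ℝ) * (T n : ℝ) ^ 2)) := by
    intro k hk
    refine ⟨16 * r * k / c ^ 2, by positivity, ?_⟩
    filter_upwards [hp.eventually_ge_atTop (max 1 ⌈16 * k / c ^ 2⌉₊), hT.eventually_ge_atTop 1]
      with n h1 h2 ω hω
    have h3 : 16 * k ≤ c ^ 2 * p n := by
      have : 16 * k / c ^ 2 ≤ p n :=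
        (Nat.le_ceil _).trans (by exact_mod_cast (le_max_right _ _).trans h1)
      rwa [div_le_iff₀ (by positivity), mul_comm (p n : ℝ)] at this
    refine ⟨h2, ?_⟩
    rw [(hK n).trace_sq]
    exact hω.frobSq_residual_le hk hc h2 ((le_max_left _ _).trans h1) h3
  have hrate0 : Tendsto (fun n => 1 / (p n : ℝ) + 1 / (T n : ℝ) ^ 2) l (𝓝 0) := by
    have h1 : Tendsto (fun n => 1 / (p n : ℝ)) l (𝓝 0) :=
      tendsto_one_div_atTop_nhds_zero_nat.comp hp
    have h2 : Tendsto (fun n => 1 / (T n : ℝ)) l (𝓝 0) :=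
      tendsto_one_div_atTop_nhds_zero_nat.comp hT
    simpa [div_pow] using h1.add (h2.pow 2)
  -- Since `tr(K²) ≤ p`, the score rate is at most `1 / p + 1 / T²`, which tends to zero.
  have hrate : ∀ n, ((D n)⁻¹ ^ 2).trace / ((p n : ℝ) * (T n : ℝ) ^ 2) ≤ 1 / (T n : ℝ) ^ 2 := by
    intro n
    rw [(hK n).trace_sq, ← div_div]
    gcongr
    exact div_le_one_of_le₀ (hK n).frobSq_le (by positivity)
  have htr : ∀ n, 0 ≤ ((D n)⁻¹ ^ 2).trace := fun n => by
    rw [(hK n).trace_sq]; exact frobSq_nonneg _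
  have hsmall : ∀ k : ℝ, 0 ≤ k → ∀ η : ℝ, 0 < η → ∀ᶠ n in l, ∀ ω, R k n ω →
      0 < T n ∧ (T n : ℝ)⁻¹ * frobSq (Fhat n ω - F n ω * rotation (F n ω) (Fhat n ω)) < η := by
    intro k hk η hη
    obtain ⟨C₁, hC₁, h⟩ := hρ k hk
    have h0 := hrate0.const_mul C₁
    rw [mul_zero] at h0
    filter_upwards [h, h0.eventually_lt_const hη] with n h1 h2 ω hω
    refine ⟨(h1 ω hω).1, ((h1 ω hω).2.trans ?_).trans_lt h2⟩
    exact mul_le_mul_of_nonneg_left (by linarith [hrate n]) hC₁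
  -- Once the normalized residual is below `1`, the regression matrix is invertible, so neither
  -- default value is active on regular samples.
  have hH : ∀ k : ℝ, 0 ≤ k → ∀ᶠ n in l, ∀ ω, R k n ω → H n ω = rotation (F n ω) (Fhat n ω) := by
    intro k hk
    filter_upwards [hsmall k hk 1 one_pos, hF] with n h1 h2 ω hω
    obtain ⟨h3, h4⟩ := h1 ω hω
    have h5 : IsUnit (rotation (F n ω) (Fhat n ω)) := by
      refine isUnit_of_frobSq_gram_lt ((hω.frobSq_rotation_gram_le h3).trans_lt ?_)
      exact pow_lt_one₀ (mul_nonneg (by positivity) (frobSq_nonneg _)) h4 two_ne_zero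
    simp only [H, if_pos h2.measurable, invertibleRotation, if_pos h5]
  -- the rate of the estimated loadings on regular samples
  have hload : ∀ k : ℝ, 0 ≤ k → ∃ C₂ : ℝ, 0 ≤ C₂ ∧ ∀ᶠ n in l, ∀ ω, R k n ω →
      (p n : ℝ)⁻¹ * frobSq (loadingEstimator (data (F n ω) (B n) (E n ω)) (D n) (Fhat n ω)
            - B n * rotation (F n ω) (Fhat n ω))
        ≤ C₂ * ((p n : ℝ)⁻¹ * frobSq (((D n)⁻¹ - 1) * B n)
          + ((D n)⁻¹ ^ 2).trace / ((p n : ℝ) * T n)) := by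
    intro k hk
    obtain ⟨C₁, hC₁, h⟩ := hρ k hk
    refine ⟨3 * (r + k * r + k * (C₁ * (C + 1))), by positivity, ?_⟩
    filter_upwards [h, hTp, hp.eventually_ge_atTop 1] with n h1 h2 h3 ω hω
    obtain ⟨hT0, h4⟩ := h1 ω hω
    rw [(hK n).trace_sq]
    refine hω.frobSq_loading_error_le hk hT0 ?_
    have hT1 : (1 : ℝ) ≤ T n := by exact_mod_cast hT0
    have hp0 : (0 : ℝ) < p n := by exact_mod_cast h3
    rw [← div_eq_inv_mul, div_le_iff₀ (by positivity)] at h4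
    refine h4.trans ?_
    rw [mul_assoc]
    gcongr
    -- Here `T ≤ C p` enters: it keeps the unnormalized squared residual bounded.
    calc _ ≤ (1 / (p n : ℝ) + 1 / (T n : ℝ) ^ 2) * T n :=
          mul_le_mul_of_nonneg_right (by linarith [hrate n]) (by positivity)
      _ = T n / p n + 1 / T n := by field_simp
      _ ≤ C + 1 := add_le_add ((div_le_iff₀ hp0).2 h2) ((div_le_one (by positivity)).2 hT1)
  refine ⟨H, ?_, ?_, ?_, ?_, ?_, ?_⟩
  · intro n i j
    by_cases h : ∀ t k, Measurable fun ω => F n ω t k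
    · simp only [H, if_pos h]
      exact measurable_invertibleRotation h (hFhat_meas n) i j
    · simp only [H, if_neg h]
      exact measurable_const
  · intro n ω
    simp only [H]
    split_ifs
    · exact isUnit_invertibleRotation _ _
    · exact isUnit_one
  · intro i j
    rw [tendstoInMeasure_iff_norm]
    intro η hη
    rw [ENNReal.tendsto_nhds_zero]
    intro δ hδ
    obtain ⟨δ', hδ', hδδ⟩ : ∃ δ' : ℝ, 0 < δ' ∧ ENNReal.ofReal δ' ≤ δ := by
      rcases eq_or_ne δ ⊤ with rfl | htop
      · exact ⟨1, one_pos, le_top⟩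
      · exact ⟨δ.toReal, ENNReal.toReal_pos hδ.ne' htop, ENNReal.ofReal_toReal_le⟩
    obtain ⟨k, hk, hRk⟩ := hR δ' hδ'
    filter_upwards [hRk, hH k hk, hsmall k hk η hη] with n h1 h2 h3
    refine (measure_mono fun ω hω hreg => ?_).trans (h1.trans hδδ)
    have hω' : η ≤ ‖((H n ω)ᵀ * H n ω) i j - (1 : Matrix (Fin r) (Fin r) ℝ) i j‖ := hω
    obtain ⟨hT0, h4⟩ := h3 ω hreg
    rw [h2 ω hreg, ← Matrix.sub_apply, Real.norm_eq_abs] at hω'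
    have h5 := (sq_apply_le_frobSq _ i j).trans (hreg.frobSq_rotation_gram_le hT0)
    have h6 := abs_le_of_sq_le_sq h5 (mul_nonneg (by positivity) (frobSq_nonneg _))
    linarith
  · refine IsBigOp.of_regular hR fun k hk => ?_
    obtain ⟨C₁, hC₁, h⟩ := hρ k hk
    refine ⟨C₁, hC₁, ?_⟩
    filter_upwards [h, hH k hk] with n h1 h2 ω hω
    rw [h2 ω hω]
    have := htr n
    exact ⟨mul_nonneg (by positivity) (frobSq_nonneg _), by positivity, (h1 ω hω).2⟩
  · refine IsBigOp.of_regular hR fun k hk => ?_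
    obtain ⟨C₂, hC₂, h⟩ := hload k hk
    refine ⟨C₂, hC₂, ?_⟩
    filter_upwards [h, hH k hk] with n h1 h2 ω hω
    rw [h2 ω hω]
    have := htr n
    have := frobSq_nonneg (((D n)⁻¹ - 1) * B n)
    exact ⟨mul_nonneg (by positivity) (frobSq_nonneg _), by positivity, h1 ω hω⟩
  · refine IsBigOp.of_regular hR fun k hk => ?_
    obtain ⟨C₁, hC₁, h₁⟩ := hρ k hk
    obtain ⟨C₂, hC₂, h₂⟩ := hload k hk
    refine ⟨3 * (C₂ + 2 * r * k * C₁), by positivity, ?_⟩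
    filter_upwards [h₁, h₂] with n h1 h2 ω hω
    obtain ⟨hT0, h3⟩ := h1 ω hω
    have h4 := h2 ω hω
    have ht := htr n
    have hb := frobSq_nonneg (((D n)⁻¹ - 1) * B n)
    refine ⟨mul_nonneg (by positivity) (frobSq_nonneg _), by positivity, ?_⟩
    have h5 := hω.frobSq_common_error_le hk hT0
      (loadingEstimator (data (F n ω) (B n) (E n ω)) (D n) (Fhat n ω))
    have hT1 : (1 : ℝ) ≤ T n := by exact_mod_cast hT0
    set x := (p n : ℝ)⁻¹ * frobSq (((D n)⁻¹ - 1) * B n) with hx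
    have hx0 : 0 ≤ x := by positivity
    set y := ((D n)⁻¹ ^ 2).trace / ((p n : ℝ) * T n) with hy
    have hy0 : 0 ≤ y := by positivity
    have hz0 : 0 ≤ 1 / (p n : ℝ) := by positivity
    -- As `T ≥ 1`, the trace term of the score rate is dominated by that of the loading rate; only
    -- `1 / p` is new.
    have h6 : ((D n)⁻¹ ^ 2).trace / ((p n : ℝ) * (T n : ℝ) ^ 2) ≤ y := by
      have e : ((D n)⁻¹ ^ 2).trace / ((p n : ℝ) * (T n : ℝ) ^ 2) = y / T n := by
        rw [hy, div_div, mul_assoc, ← sq]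
      rw [e]
      exact div_le_self hy0 hT1
    calc _ ≤ _ := h5
      _ ≤ 3 * (C₂ * (x + y + 1 / (p n : ℝ)) + 2 * r * k * (C₁ * (x + y + 1 / (p n : ℝ)))) := by
          have f1 := h4.trans
            (mul_le_mul_of_nonneg_left (by linarith : x + y ≤ x + y + 1 / (p n : ℝ)) hC₂)
          have f2 := h3.trans (mul_le_mul_of_nonneg_left
            (by linarith [h6] : _ ≤ x + y + 1 / (p n : ℝ)) hC₁)
          have f3 := mul_le_mul_of_nonneg_left f2 (by positivity : 0 ≤ 2 * r * k)
          linarith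
      _ = _ := by ring
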